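/- **Setting.** Let $l>0$, $r\le m$, and let $J_1=\mathrm{diag}(I_r,0)$, $J_2=\mathrm{diag}(0,I_{m-r})$, $L=J_1-J_2+S+S^*$, where $S=\begin{pmatrix}0&0\\ \widehat S&0\end{pmatrix}$ is a complex $m\times m$ matrix with $\widehat S$ of size $(m-r)\times r$. Let $\Pi(w)$ be a measurable $p\times m$ matrix function on $\Delta=[-l,l]$ such that for all $w\in\Delta$: $\mathrm{tr}\,\Pi^*(w)\Pi(w)=1$, $\Pi^*(w)\Pi(w)J_1=J_1\Pi^*(w)\Pi(w)$, $\Pi^*\Pi$ is Hölder continuous with some exponent in $(0,1]$, and $\Pi(w)Q(w)=I$ for some $m\times p$ matrix $Q(w)$. On $H=L^2(\Delta;\mathbb C^p)$ (row vectors) let $B$ be the triangular model of a coupling of a dissipative and an antidissipative operator with absolutely continuous real spectra, $$Bf(w)=wf(w)-i\int_{-l}^w f(\xi)\Pi(\xi)S^*\Pi^*(w)\,d\xi+i\int_w^l f(\xi)\Pi(\xi)S\Pi^*(w)\,d\xi+i\int_{-l}^w f(\xi)\Pi(\xi)L\Pi^*(w)\,d\xi ,$$ and assume $B^*=-UBU^*$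 for a unitary operator $U$ on $H$. Let $A=bB^3$ with $b\in\mathbb R$, $T(x,t)=e^{i(tA+xB)}$, ${T^*}^{-1}(x,t)=e^{i(tA^*+xB^*)}$, $G_B=(B-B^*)H$. Let $g_\alpha\in H$, $g_\alpha(w)=(\Pi^*(w))_\alpha$ (the $\alpha$-th row of $\Pi^*(w)$), be the channel elements of $B$, and let $\widetilde\Phi:H\to\mathbb C^{3m}$, $$\widetilde\Phi f=\bigl((f,g_\alpha)_{\alpha},(f,Bg_\alpha)_{\alpha},(f,B^2g_\alpha)_{\alpha}\bigr),\qquad \sigma_B=\mathrm{diag}(L,0,0)\ \text{ (acting on row vectors)}.$$ Let $\rho$ be a bounded operator on $H$ for which the strong limit $$M=\int_0^\infty e^{-i\eta B^*}\rho\,\frac{B-B^*}{i}\,e^{i\eta B}\,d\eta$$ exists as a bounded operator on $H$, and put $\widetilde\rho=U^*\rho$, $\Psi(x,t)=\widetilde\Phi T(x,t)\widetilde\rho\widetilde\Phi^*\sigma_B$, $\Gamma(x,t)=T(x,t)+U^*{T^*}^{-1}(x,t)M$ and, where $\Gamma(x,t)$ is invertible, $S(x,t)=\Gamma^{-1}(x,t)\Gamma_x(x,t)$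 (the solitonic combination). Let $\widehat H=\overline{\mathrm{span}}\{B^n\widetilde\Phi^*e: n\ge 0,\ e\in\mathbb C^{3m}\}$, $v_h(\xi)=\widetilde\Phi e^{i\xi B}h$, $\widetilde H=\{v_h:h\in\widehat H\}$ with the scalar product $$\langle v_h,v_f\rangle=\lim_{R\to\infty}\Bigl[(e^{iRB}h,e^{iRB}f)+\int_0^R(\sigma_Bv_h(\xi),v_f(\xi))\,d\xi\Bigr],$$ and let $\widetilde U:\widehat H\to\widetilde H$, $\widetilde Uh=v_h$. **Theorem.** Let $g\in G_B$ and let $\Omega\subseteq\mathbb R^2$ be an open set at every point $(x,t)$ of which $\Gamma(x,t)$ is (boundedly) invertible. Suppose that for every $(x,t)\in\Omega$ the function $\varphi=\varphi_{x,t}\in\widetilde H$ satisfies, for all $\xi\ge 0$, $$\varphi(\xi)=-\int_0^\infty\Psi(-2x+\xi+\eta,-2t)\,\varphi(\eta)\,d\eta+\Psi(-2x+\xi,-2t)\,\widetilde\Phi g$$ (with a convergent improper integral), and let $h(x,t)=\widetilde U^*\varphi_{x,t}\in\widehat H$, so that $\varphi_{x,t}=v_{h(x,t)}$. Then, on $\Omega$,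 $$u(x,t):=h(x,t)+iBg=S(x,t)g,$$ $S$ (in the operator norm) and $u$ are infinitely differentiable, $S$ satisfies the nonlinear operator KdV equation $$4S_t+b\,(6S_x^2+S_{xxx})=0,$$ and $u$ satisfies it in the form $4u_t+b\,(6S_xu_x+u_{xxx})=0$, where $S_xu_x=S_x^2g$. For $b=4$, i.e. $A=4B^3$, these are the equations $S_t+6S_x^2+S_{xxx}=0$ and $u_t+6S_xu_x+u_{xxx}=0$. -/

import Mathlib

open MeasureTheory Filter Topology
open scoped Matrix ENNReal

noncomputable section

namespace KdVColligation

/-- The Hilbert space `L²([-l, l]; ℂᵖ)`; its elements are regarded as row-vector functions. -/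
abbrev StateSpace (l : ℝ) (p : ℕ) : Type :=
  Lp (EuclideanSpace ℂ (Fin p)) 2 (volume.restrict (Set.Icc (-l) l))

/-- The external space `ℂ³ᵐ`, written as three blocks of length `m`. -/
abbrev OuterSpace (m : ℕ) : Type := EuclideanSpace ℂ (Fin 3 × Fin m)

/-- The diagonal matrix `J₁ = diag (I_r, 0)`. -/
def J₁ (m r : ℕ) : Matrix (Fin m) (Fin m) ℂ :=
  Matrix.diagonal fun i => if (i : ℕ) < r then 1 else 0

/-- The diagonal matrix `J₂ = diag (0, I_{m-r})`. -/
def J₂ (m r : ℕ) : Matrix (Fin m) (Fin m) ℂ :=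
  Matrix.diagonal fun i => if (i : ℕ) < r then 0 else 1

/-- The data of the triangular model of a coupling of a dissipative and an antidissipative operator
with absolutely continuous real spectra, on the interval `[-l, l]`: a block lower triangular
matrix `S` and a `p × m` matrix function `Π`. -/
structure TriangularData (l : ℝ) (p m r : ℕ) where
  l_pos : 0 < l
  r_le : r ≤ m
  /-- The matrix `S`, whose only nonzero block is the lower left one, of size `(m - r) × r`. -/
  S : Matrix (Fin m) (Fin m) ℂ
  S_block : ∀ i j, S i j ≠ 0 → r ≤ (i : ℕ) ∧ (j : ℕ) < r
  /-- The matrix function `Π(w)`. -/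
  PiM : ℝ → Matrix (Fin p) (Fin m) ℂ
  meas : ∀ i j, AEStronglyMeasurable (fun w => PiM w i j) (volume.restrict (Set.Icc (-l) l))
  trace_eq : ∀ w ∈ Set.Icc (-l) l, ((PiM w)ᴴ * PiM w).trace = 1
  comm : ∀ w ∈ Set.Icc (-l) l, (PiM w)ᴴ * PiM w * J₁ m r = J₁ m r * ((PiM w)ᴴ * PiM w)
  holder : ∃ C > (0 : ℝ), ∃ a ∈ Set.Ioc (0 : ℝ) 1, ∀ w₁ ∈ Set.Icc (-l) l, ∀ w₂ ∈ Set.Icc (-l) l,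
    ∀ i j, ‖((PiM w₁)ᴴ * PiM w₁) i j - ((PiM w₂)ᴴ * PiM w₂) i j‖ ≤ C * |w₁ - w₂| ^ a
  /-- The rows of `Π(w)` are linearly independent: `Π(w) Q(w) = I` for some matrix `Q(w)`. -/
  right_inv : ∀ w ∈ Set.Icc (-l) l, ∃ Q : Matrix (Fin m) (Fin p) ℂ, PiM w * Q = 1

namespace TriangularData

variable {l : ℝ} {p m r : ℕ} (D : TriangularData l p m r)

/-- The selfadjoint matrix `L = J₁ - J₂ + S + S*`.  It is automatically invertible, with `r`
positive and `m - r` negative eigenvalues. -/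
def L : Matrix (Fin m) (Fin m) ℂ := J₁ m r - J₂ m r + D.S + D.Sᴴ

/-- The row vector `∫_a^c f(ξ) Π(ξ) dξ`. -/
def rowIntegral (f : StateSpace l p) (a c : ℝ) : Fin m → ℂ :=
  ∫ ξ in a..c, (f ξ).ofLp ᵥ* D.PiM ξ

/-- The integral part of the triangular model (the constant matrices and `Π*(w)` are taken out of
the integrals over `ξ`):
`-i ∫_{-l}^w f Π S* Π*(w) + i ∫_w^l f Π S Π*(w) + i ∫_{-l}^w f Π L Π*(w)`. -/
def kernelFun (f : StateSpace l p) (w : ℝ) : EuclideanSpace ℂ (Fin p) :=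
  WithLp.toLp 2 (
    -Complex.I • ((D.rowIntegral f (-l) w ᵥ* D.Sᴴ) ᵥ* (D.PiM w)ᴴ)
    + Complex.I • ((D.rowIntegral f w l ᵥ* D.S) ᵥ* (D.PiM w)ᴴ)
    + Complex.I • ((D.rowIntegral f (-l) w ᵥ* D.L) ᵥ* (D.PiM w)ᴴ))

/-- The function `w ↦ Π*(w)_α`, whose class is the channel element `g_α = Φ* e_α`. -/
def channelFun (α : Fin m) (w : ℝ) : EuclideanSpace ℂ (Fin p) :=
  WithLp.toLp 2 fun j => star (D.PiM w j α)

lemma norm_PiM_le {w : ℝ} (hw : w ∈ Set.Icc (-l) l) (i : Fin p) (j : Fin m) :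
    ‖D.PiM w i j‖ ≤ 1 := by
  have h := D.trace_eq w hw
  have h2 : ∑ j, ∑ i, ‖D.PiM w i j‖ ^ 2 = (1 : ℝ) := by
    have h3 : ((∑ j, ∑ i, ‖D.PiM w i j‖ ^ 2 : ℝ) : ℂ) = 1 := by
      rw [← h]
      simp only [Matrix.trace, Matrix.diag, Matrix.mul_apply, Matrix.conjTranspose_apply]
      push_cast
      refine Finset.sum_congr rfl fun j _ => Finset.sum_congr rfl fun i _ => ?_
      rw [Complex.star_def, mul_comm, Complex.mul_conj, Complex.normSq_eq_norm_sq]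
      push_cast; rfl
    exact_mod_cast h3
  have h4 : ‖D.PiM w i j‖ ^ 2 ≤ 1 := by
    rw [← h2]
    calc ‖D.PiM w i j‖ ^ 2 ≤ ∑ i, ‖D.PiM w i j‖ ^ 2 :=
          Finset.single_le_sum (f := fun i => ‖D.PiM w i j‖ ^ 2)
            (fun _ _ => by positivity) (Finset.mem_univ i)
      _ ≤ _ := Finset.single_le_sum (f := fun j => ∑ i, ‖D.PiM w i j‖ ^ 2)
            (fun _ _ => by positivity) (Finset.mem_univ j)
  nlinarith [norm_nonneg (D.PiM w i j)]

lemma memLp_channelFun (α : Fin m) :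
    MemLp (D.channelFun α) 2 (volume.restrict (Set.Icc (-l) l)) := by
  rw [memLp_piLp_iff]
  intro j
  refine MemLp.of_bound (C := 1) ?_ ?_
  · exact continuous_star.comp_aestronglyMeasurable (D.meas j α)
  · filter_upwards [ae_restrict_mem measurableSet_Icc] with w hw
    simpa [channelFun] using D.norm_PiM_le hw j α

/-- The channel element `g_α = Φ* e_α` in `L²([-l, l]; ℂᵖ)`. -/
def channel (α : Fin m) : StateSpace l p := (D.memLp_channelFun α).toLp _

lemma norm_vecMul_le {w : ℝ} (hw : w ∈ Set.Icc (-l) l) (x : EuclideanSpace ℂ (Fin p)) :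
    ‖x.ofLp ᵥ* D.PiM w‖ ≤ p * ‖x‖ := by
  rw [pi_norm_le_iff_of_nonneg (by positivity)]
  intro α
  calc ‖∑ i, x i * D.PiM w i α‖ ≤ ∑ i, ‖x i * D.PiM w i α‖ := norm_sum_le _ _
    _ ≤ ∑ _i : Fin p, ‖x‖ := by
        refine Finset.sum_le_sum fun i _ => ?_
        rw [norm_mul]
        calc ‖x i‖ * ‖D.PiM w i α‖ ≤ ‖x‖ * 1 := by
              gcongr
              · exact PiLp.norm_apply_le x i
              · exact D.norm_PiM_le hw i α
          _ = ‖x‖ := mul_one _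
    _ = p * ‖x‖ := by simp

lemma integrable_norm (f : StateSpace l p) :
    Integrable (fun ξ => f ξ) (volume.restrict (Set.Icc (-l) l)) :=
  (Lp.memLp f).integrable (by norm_num)

lemma integrableOn_row (f : StateSpace l p) :
    IntegrableOn (fun ξ => (f ξ).ofLp ᵥ* D.PiM ξ) (Set.Icc (-l) l) := by
  refine Integrable.mono' (g := fun ξ => p * ‖f ξ‖) ((integrable_norm f).norm.const_mul _) ?_ ?_
  · refine AEMeasurable.aestronglyMeasurable (aemeasurable_pi_iff.2 fun α => ?_)
    refine AEStronglyMeasurable.aemeasurable ?_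
    simp only [Matrix.vecMul, dotProduct]
    refine Finset.aestronglyMeasurable_fun_sum _ fun i _ => ?_
    refine AEStronglyMeasurable.mul ?_ (D.meas i α)
    exact (EuclideanSpace.proj (𝕜 := ℂ) i).continuous.comp_aestronglyMeasurable
      (Lp.aestronglyMeasurable f)
  · filter_upwards [ae_restrict_mem measurableSet_Icc] with w hw
    exact D.norm_vecMul_le hw _

lemma intervalIntegrable_row (f : StateSpace l p) {a c : ℝ} (ha : a ∈ Set.Icc (-l) l)
    (hc : c ∈ Set.Icc (-l) l) :
    IntervalIntegrable (fun ξ => (f ξ).ofLp ᵥ* D.PiM ξ) volume a c :=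
  ((D.integrableOn_row f).mono_set (Set.uIcc_subset_Icc ha hc)).intervalIntegrable

lemma rowIntegral_add (f g : StateSpace l p) {a c : ℝ} (ha : a ∈ Set.Icc (-l) l)
    (hc : c ∈ Set.Icc (-l) l) :
    D.rowIntegral (f + g) a c = D.rowIntegral f a c + D.rowIntegral g a c := by
  unfold rowIntegral
  rw [← intervalIntegral.integral_add (D.intervalIntegrable_row f ha hc)
    (D.intervalIntegrable_row g ha hc)]
  refine intervalIntegral.integral_congr_ae ?_
  have h := (ae_restrict_iff' measurableSet_Icc).1 (Lp.coeFn_add f g)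
  filter_upwards [h] with x hx hxm
  rw [hx (Set.uIcc_subset_Icc ha hc (Set.uIoc_subset_uIcc hxm))]
  simp [Matrix.add_vecMul]

lemma rowIntegral_smul (k : ℂ) (f : StateSpace l p) {a c : ℝ} (ha : a ∈ Set.Icc (-l) l)
    (hc : c ∈ Set.Icc (-l) l) :
    D.rowIntegral (k • f) a c = k • D.rowIntegral f a c := by
  unfold rowIntegral
  rw [← intervalIntegral.integral_smul]
  refine intervalIntegral.integral_congr_ae ?_
  have h := (ae_restrict_iff' measurableSet_Icc).1 (Lp.coeFn_smul k f)
  filter_upwards [h] with x hx hxm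
  rw [hx (Set.uIcc_subset_Icc ha hc (Set.uIoc_subset_uIcc hxm))]
  simp [Matrix.smul_vecMul]

lemma exists_integral_norm_le (l : ℝ) (p : ℕ) : ∃ C : ℝ, 0 ≤ C ∧ ∀ f : StateSpace l p,
    ∫ ξ in Set.Icc (-l) l, ‖f ξ‖ ≤ C * ‖f‖ := by
  let e : ℝ≥0∞ := (volume.restrict (Set.Icc (-l) l)) Set.univ ^ ((1 : ℝ) - 1 / 2)
  have he : e ≠ ∞ := ENNReal.rpow_ne_top_of_nonneg (by norm_num) (measure_ne_top _ _)
  refine ⟨e.toReal, ENNReal.toReal_nonneg, fun f => ?_⟩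
  have h := eLpNorm_le_eLpNorm_mul_rpow_measure_univ (μ := volume.restrict (Set.Icc (-l) l))
    (p := 1) (q := 2) (by norm_num) (Lp.aestronglyMeasurable f)
  rw [integral_norm_eq_lintegral_enorm (Lp.aestronglyMeasurable f), ← eLpNorm_one_eq_lintegral_enorm,
    Lp.norm_def, mul_comm, ← ENNReal.toReal_mul]
  refine ENNReal.toReal_mono (ENNReal.mul_ne_top (Lp.eLpNorm_ne_top f) he) ?_
  simpa [e] using h

lemma exists_rowIntegral_le : ∃ C : ℝ, 0 ≤ C ∧ ∀ f : StateSpace l p,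
    ∀ a ∈ Set.Icc (-l) l, ∀ c ∈ Set.Icc (-l) l, ‖D.rowIntegral f a c‖ ≤ C * ‖f‖ := by
  obtain ⟨C, hC, h⟩ := exists_integral_norm_le l p
  refine ⟨p * C, by positivity, fun f a ha c hc => ?_⟩
  have hsub : Set.uIoc a c ⊆ Set.Icc (-l) l :=
    Set.uIoc_subset_uIcc.trans (Set.uIcc_subset_Icc ha hc)
  calc ‖D.rowIntegral f a c‖ ≤ ∫ ξ in Set.uIoc a c, ‖(f ξ).ofLp ᵥ* D.PiM ξ‖ :=
        intervalIntegral.norm_integral_le_integral_norm_uIoc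
    _ ≤ ∫ ξ in Set.Icc (-l) l, ‖(f ξ).ofLp ᵥ* D.PiM ξ‖ :=
        setIntegral_mono_set (D.integrableOn_row f).norm
          (Eventually.of_forall fun _ => norm_nonneg _) hsub.eventuallyLE
    _ ≤ ∫ ξ in Set.Icc (-l) l, p * ‖f ξ‖ :=
        setIntegral_mono_on (D.integrableOn_row f).norm ((integrable_norm f).norm.const_mul _)
          measurableSet_Icc fun w hw => D.norm_vecMul_le hw _
    _ = p * ∫ ξ in Set.Icc (-l) l, ‖f ξ‖ := integral_const_mul _ _
    _ ≤ p * (C * ‖f‖) := by gcongr; exact h f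
    _ = p * C * ‖f‖ := by ring

lemma continuousOn_rowIntegral_left (f : StateSpace l p) :
    ContinuousOn (fun w => D.rowIntegral f (-l) w) (Set.Icc (-l) l) := by
  have hl : -l ≤ l := by linarith [D.l_pos]
  have := intervalIntegral.continuousOn_primitive_interval
    (f := fun ξ => (f ξ).ofLp ᵥ* D.PiM ξ) (μ := volume) (a := -l) (b := l)
    (by rw [Set.uIcc_of_le hl]; exact D.integrableOn_row f)
  rwa [Set.uIcc_of_le hl] at this

lemma continuousOn_rowIntegral_right (f : StateSpace l p) :
    ContinuousOn (fun w => D.rowIntegral f w l) (Set.Icc (-l) l) := by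
  have hl : -l ≤ l := by linarith [D.l_pos]
  have := intervalIntegral.continuousOn_primitive_interval_left
    (f := fun ξ => (f ξ).ofLp ᵥ* D.PiM ξ) (μ := volume) (a := -l) (b := l)
    (by rw [Set.uIcc_of_le hl]; exact D.integrableOn_row f)
  rwa [Set.uIcc_of_le hl] at this

lemma norm_vecMul_const_le (N : Matrix (Fin m) (Fin m) ℂ) :
    ∃ C : ℝ, 0 ≤ C ∧ ∀ v : Fin m → ℂ, ‖v ᵥ* N‖ ≤ C * ‖v‖ :=
  ⟨‖(Matrix.vecMulLinear N).toContinuousLinearMap‖, norm_nonneg _, fun v =>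
    (Matrix.vecMulLinear N).toContinuousLinearMap.le_opNorm v⟩

/-- A summand of the kernel operator is square integrable. -/
lemma memLp_term {F : ℝ → Fin m → ℂ} (hF : ContinuousOn F (Set.Icc (-l) l))
    (N : Matrix (Fin m) (Fin m) ℂ) (j : Fin p) :
    MemLp (fun w => ((F w ᵥ* N) ᵥ* (D.PiM w)ᴴ) j) 2 (volume.restrict (Set.Icc (-l) l)) := by
  have hcomp : ∀ β, ContinuousOn (fun w => (F w ᵥ* N) β) (Set.Icc (-l) l) := fun β =>
    (continuous_apply β).comp_continuousOn
      ((LinearMap.continuous_of_finiteDimensional (Matrix.vecMulLinear N)).comp_continuousOn hF)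
  have : (fun w => ((F w ᵥ* N) ᵥ* (D.PiM w)ᴴ) j)
      = fun w => ∑ β, (F w ᵥ* N) β * star (D.PiM w j β) := by
    funext w
    rfl
  rw [this]
  refine memLp_finsetSum _ fun β _ => ?_
  obtain ⟨C, hC⟩ := isCompact_Icc.exists_bound_of_continuousOn (hcomp β)
  refine MemLp.of_bound (C := C) ?_ ?_
  · exact ((hcomp β).aestronglyMeasurable measurableSet_Icc).mul
      (continuous_star.comp_aestronglyMeasurable (D.meas j β))
  · filter_upwards [ae_restrict_mem measurableSet_Icc] with w hw
    rw [norm_mul, norm_star]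
    have h1 := hC w hw
    have h2 := D.norm_PiM_le hw j β
    nlinarith [norm_nonneg ((F w ᵥ* N) β), norm_nonneg (D.PiM w j β)]

lemma memLp_kernelFun (f : StateSpace l p) :
    MemLp (D.kernelFun f) 2 (volume.restrict (Set.Icc (-l) l)) := by
  rw [memLp_piLp_iff]
  intro j
  exact ((((D.memLp_term (D.continuousOn_rowIntegral_left f) D.Sᴴ j).const_mul _).add
    ((D.memLp_term (D.continuousOn_rowIntegral_right f) D.S j).const_mul _)).add
    ((D.memLp_term (D.continuousOn_rowIntegral_left f) D.L j).const_mul _))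

lemma norm_toLp_conj_le {w : ℝ} (hw : w ∈ Set.Icc (-l) l) (v : Fin m → ℂ) :
    ‖(WithLp.toLp 2 (v ᵥ* (D.PiM w)ᴴ) : EuclideanSpace ℂ (Fin p))‖ ≤ p * (m * ‖v‖) := by
  have h1 : ∀ j, ‖(v ᵥ* (D.PiM w)ᴴ) j‖ ≤ m * ‖v‖ := by
    intro j
    calc ‖∑ β, v β * star (D.PiM w j β)‖ ≤ ∑ β, ‖v β * star (D.PiM w j β)‖ := norm_sum_le _ _
      _ ≤ ∑ _β : Fin m, ‖v‖ := by
          refine Finset.sum_le_sum fun β _ => ?_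
          rw [norm_mul, norm_star]
          calc ‖v β‖ * ‖D.PiM w j β‖ ≤ ‖v‖ * 1 := by
                gcongr
                · exact norm_le_pi_norm v β
                · exact D.norm_PiM_le hw j β
            _ = ‖v‖ := mul_one _
      _ = m * ‖v‖ := by simp
  have h2 : (WithLp.toLp 2 (v ᵥ* (D.PiM w)ᴴ) : EuclideanSpace ℂ (Fin p))
      = ∑ j, EuclideanSpace.single j ((v ᵥ* (D.PiM w)ᴴ) j) := by
    ext i
    simp [Finset.sum_apply, Pi.single_apply]
  rw [h2]
  calc _ ≤ ∑ j, ‖EuclideanSpace.single j ((v ᵥ* (D.PiM w)ᴴ) j)‖ := norm_sum_le _ _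
    _ ≤ ∑ _j : Fin p, m * ‖v‖ := Finset.sum_le_sum fun j _ => by
        rw [PiLp.norm_single]; exact h1 j
    _ = p * (m * ‖v‖) := by simp

lemma exists_kernelFun_le : ∃ C : ℝ, 0 ≤ C ∧ ∀ f : StateSpace l p,
    ∀ w ∈ Set.Icc (-l) l, ‖D.kernelFun f w‖ ≤ C * ‖f‖ := by
  obtain ⟨C, hC, h⟩ := D.exists_rowIntegral_le
  obtain ⟨C₁, hC₁, h₁⟩ := norm_vecMul_const_le D.Sᴴ
  obtain ⟨C₂, hC₂, h₂⟩ := norm_vecMul_const_le D.S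
  obtain ⟨C₃, hC₃, h₃⟩ := norm_vecMul_const_le D.L
  have hl : -l ≤ l := by linarith [D.l_pos]
  have hbound : ∀ (K : ℝ) (v : Fin m → ℂ) (N : Matrix (Fin m) (Fin m) ℂ) (f : StateSpace l p)
      (w : ℝ), 0 ≤ K → (∀ v : Fin m → ℂ, ‖v ᵥ* N‖ ≤ K * ‖v‖) → w ∈ Set.Icc (-l) l →
      ‖v‖ ≤ C * ‖f‖ →
      ‖(WithLp.toLp 2 ((v ᵥ* N) ᵥ* (D.PiM w)ᴴ) : EuclideanSpace ℂ (Fin p))‖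
        ≤ p * (m * (K * (C * ‖f‖))) := by
    intro K v N f w hK hN hw hv
    refine (D.norm_toLp_conj_le hw _).trans ?_
    gcongr
    exact (hN v).trans (by gcongr)
  refine ⟨p * (m * (C₁ * C)) + p * (m * (C₂ * C)) + p * (m * (C₃ * C)), by positivity,
    fun f w hw => ?_⟩
  have e1 := hbound C₁ _ D.Sᴴ f w hC₁ h₁ hw (h f (-l) ⟨le_rfl, hl⟩ w hw)
  have e2 := hbound C₂ _ D.S f w hC₂ h₂ hw (h f w hw l ⟨hl, le_rfl⟩)
  have e3 := hbound C₃ _ D.L f w hC₃ h₃ hw (h f (-l) ⟨le_rfl, hl⟩ w hw)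
  unfold kernelFun
  rw [WithLp.toLp_add, WithLp.toLp_add, WithLp.toLp_smul, WithLp.toLp_smul, WithLp.toLp_smul]
  refine (norm_add₃_le).trans ?_
  simp only [norm_smul, norm_neg, Complex.norm_I, one_mul]
  linarith

/-- The integral part of the triangular model, as a bounded operator. -/
def kernelOp : StateSpace l p →L[ℂ] StateSpace l p :=
  LinearMap.mkContinuousOfExistsBound
    { toFun := fun f => (D.memLp_kernelFun f).toLp _
      map_add' := by
        intro f g
        rw [← MemLp.toLp_add]
        refine MemLp.toLp_congr _ _ ?_
        filter_upwards [ae_restrict_mem measurableSet_Icc] with w hw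
        have hl : -l ≤ l := by linarith [D.l_pos]
        simp only [Pi.add_apply, kernelFun,
          D.rowIntegral_add f g (show -l ∈ Set.Icc (-l) l from ⟨le_rfl, hl⟩) hw,
          D.rowIntegral_add f g hw (show l ∈ Set.Icc (-l) l from ⟨hl, le_rfl⟩),
          Matrix.add_vecMul, smul_add, WithLp.toLp_add]
        abel
      map_smul' := by
        intro k f
        rw [RingHom.id_apply, ← MemLp.toLp_const_smul]
        refine MemLp.toLp_congr _ _ ?_
        filter_upwards [ae_restrict_mem measurableSet_Icc] with w hw
        have hl : -l ≤ l := by linarith [D.l_pos]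
        simp only [Pi.smul_apply, kernelFun,
          D.rowIntegral_smul k f (show -l ∈ Set.Icc (-l) l from ⟨le_rfl, hl⟩) hw,
          D.rowIntegral_smul k f hw (show l ∈ Set.Icc (-l) l from ⟨hl, le_rfl⟩),
          Matrix.smul_vecMul, WithLp.toLp_add, WithLp.toLp_smul, smul_add,
          smul_comm k] }
    (by
      obtain ⟨C, hC, h⟩ := D.exists_kernelFun_le
      refine ⟨(measureUnivNNReal (volume.restrict (Set.Icc (-l) l)) : ℝ)
        ^ ((2 : ℝ≥0∞).toReal)⁻¹ * C, fun f => ?_⟩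
      refine (Lp.norm_le_of_ae_bound (C := C * ‖f‖) (by positivity) ?_).trans_eq
        (mul_assoc _ _ _).symm
      filter_upwards [ae_restrict_mem measurableSet_Icc,
        MemLp.coeFn_toLp (D.memLp_kernelFun f)] with w hw hfw
      change ‖((D.memLp_kernelFun f).toLp _ : ℝ → EuclideanSpace ℂ (Fin p)) w‖ ≤ _
      rw [hfw]
      exact h f w hw)

end TriangularData

lemma memLp_mulVar (l : ℝ) (p : ℕ) (f : StateSpace l p) :
    MemLp (fun w : ℝ => (w : ℂ) • f w) 2 (volume.restrict (Set.Icc (-l) l)) := by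
  refine (Lp.memLp f).of_le_mul (c := |l|) ?_ ?_
  · exact Complex.continuous_ofReal.aestronglyMeasurable.smul (Lp.aestronglyMeasurable f)
  · filter_upwards [ae_restrict_mem measurableSet_Icc] with w hw
    rw [norm_smul, Complex.norm_real]
    gcongr
    exact (abs_le.2 hw).trans (le_abs_self l)

/-- Multiplication by the independent variable on `L²([-l, l]; ℂᵖ)`. -/
def mulVar (l : ℝ) (p : ℕ) : StateSpace l p →L[ℂ] StateSpace l p :=
  LinearMap.mkContinuous
    { toFun := fun f => (memLp_mulVar l p f).toLp _
      map_add' := by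
        intro f g
        rw [← MemLp.toLp_add]
        refine MemLp.toLp_congr _ _ ?_
        filter_upwards [Lp.coeFn_add f g] with w hw
        simp only [hw, Pi.add_apply, smul_add]
      map_smul' := by
        intro k f
        rw [RingHom.id_apply, ← MemLp.toLp_const_smul]
        refine MemLp.toLp_congr _ _ ?_
        filter_upwards [Lp.coeFn_smul k f] with w hw
        simp only [hw, Pi.smul_apply, smul_comm k] }
    |l|
    (by
      intro f
      refine Lp.norm_le_mul_norm_of_ae_le_mul ?_
      filter_upwards [ae_restrict_mem measurableSet_Icc,
        MemLp.coeFn_toLp (memLp_mulVar l p f)] with w hw hfw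
      change ‖((memLp_mulVar l p f).toLp _ : ℝ → EuclideanSpace ℂ (Fin p)) w‖ ≤ _
      rw [hfw, norm_smul, Complex.norm_real]
      gcongr
      exact (abs_le.2 hw).trans (le_abs_self l))

namespace TriangularData

variable {l : ℝ} {p m r : ℕ} (D : TriangularData l p m r)

/-- The triangular model
`B f(w) = w f(w) - i ∫_{-l}^w f Π S* Π*(w) + i ∫_w^l f Π S Π*(w) + i ∫_{-l}^w f Π L Π*(w)`. -/
def B : StateSpace l p →L[ℂ] StateSpace l p := mulVar l p + D.kernelOp

/-- The operator `A = b B³`. -/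
def A (b : ℝ) : StateSpace l p →L[ℂ] StateSpace l p := (b : ℂ) • D.B ^ 3

/-- The imaginary part `(B - B*) / i`. -/
def imB : StateSpace l p →L[ℂ] StateSpace l p :=
  (Complex.I)⁻¹ • (D.B - ContinuousLinearMap.adjoint D.B)

/-- The nonhermitian subspace `G_B = (B - B*) H`. -/
def GB : Submodule ℂ (StateSpace l p) :=
  LinearMap.range (D.B - ContinuousLinearMap.adjoint D.B).toLinearMap

/-- The operator `Φ̃ : H → ℂ³ᵐ`,
`Φ̃ f = ((f, g_α)_α, (f, B g_α)_α, (f, B² g_α)_α)`.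
The inner product of Mathlib is linear in the second argument. -/
def PhiT : StateSpace l p →L[ℂ] OuterSpace m :=
  (EuclideanSpace.equiv (Fin 3 × Fin m) ℂ).symm.toContinuousLinearMap ∘L
    ContinuousLinearMap.pi fun x : Fin 3 × Fin m =>
      innerSL ℂ ((D.B ^ (x.1 : ℕ)) (D.channel x.2))

/-- The matrix `σ_B = diag (L, 0, 0)` acting on row vectors in `ℂ³ᵐ`, `v ↦ v σ_B`. -/
def sigmaB : OuterSpace m →L[ℂ] OuterSpace m :=
  Matrix.toEuclideanCLM (𝕜 := ℂ)
    (Matrix.of fun x y : Fin 3 × Fin m => if x.1 = 0 ∧ y.1 = 0 then D.L y.2 x.2 else 0)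

/-- The exponential `exp(i (t A + x B))`: the collective motion `T(x, t)`. -/
def T (b x t : ℝ) : StateSpace l p →L[ℂ] StateSpace l p :=
  NormedSpace.exp (Complex.I • ((t : ℂ) • D.A b + (x : ℂ) • D.B))

/-- The collective motion `T*⁻¹(x, t) = exp(i (t A* + x B*))`. -/
def TStarInv (b x t : ℝ) : StateSpace l p →L[ℂ] StateSpace l p :=
  NormedSpace.exp (Complex.I • ((t : ℂ) • ContinuousLinearMap.adjoint (D.A b)
    + (x : ℂ) • ContinuousLinearMap.adjoint D.B))

/-- The group `exp(i ξ B)`. -/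
def expB (ξ : ℝ) : StateSpace l p →L[ℂ] StateSpace l p :=
  NormedSpace.exp ((Complex.I * ξ) • D.B)

/-- The group `exp(-i ξ B*)`. -/
def expNegBStar (ξ : ℝ) : StateSpace l p →L[ℂ] StateSpace l p :=
  NormedSpace.exp ((-(Complex.I * ξ)) • ContinuousLinearMap.adjoint D.B)

/-- `M = ∫_0^∞ exp(-i η B*) ρ ((B - B*) / i) exp(i η B) dη`, as a strong limit. -/
def IsStrongIntegral (ρ M : StateSpace l p →L[ℂ] StateSpace l p) : Prop :=
  ∀ f : StateSpace l p,
    Tendsto (fun R : ℝ => ∫ η in (0 : ℝ)..R, D.expNegBStar η (ρ (D.imB (D.expB η f)))) atTop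
      (𝓝 (M f))

/-- `Γ(x, t) = T(x, t) + M₁ T*⁻¹(x, t) M` with `M₁ = U*`. -/
def Gam (b : ℝ) (U M : StateSpace l p →L[ℂ] StateSpace l p) (x t : ℝ) :
    StateSpace l p →L[ℂ] StateSpace l p :=
  D.T b x t + ContinuousLinearMap.adjoint U * D.TStarInv b x t * M

/-- The solitonic combination `S(x, t) = Γ⁻¹(x, t) Γ_x(x, t)`; it is meant only where `Γ(x, t)`
is invertible. -/
def soliton (b : ℝ) (U M : StateSpace l p →L[ℂ] StateSpace l p) (x t : ℝ) :
    StateSpace l p →L[ℂ] StateSpace l p :=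
  Ring.inverse (D.Gam b U M x t) * deriv (fun y => D.Gam b U M y t) x

/-- `Ψ(x, t) = Φ̃ T(x, t) ρ̃ Φ̃* σ_B` with `ρ̃ = U* ρ`. -/
def Psi (b : ℝ) (U ρ : StateSpace l p →L[ℂ] StateSpace l p) (x t : ℝ) :
    OuterSpace m →L[ℂ] OuterSpace m :=
  D.PhiT ∘L D.T b x t ∘L (ContinuousLinearMap.adjoint U * ρ) ∘L
    ContinuousLinearMap.adjoint D.PhiT ∘L D.sigmaB

/-- The principal subspace `Ĥ`, the closed linear span of the vectors `Bⁿ Φ̃* e`. -/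
def principal : Submodule ℂ (StateSpace l p) :=
  (Submodule.span ℂ {f | ∃ (n : ℕ) (e : OuterSpace m),
    f = (D.B ^ n) (ContinuousLinearMap.adjoint D.PhiT e)}).topologicalClosure

/-- The mode `v_h(ξ) = Φ̃ exp(i ξ B) h`; on `Ĥ` the map `h ↦ v_h` is the operator `Ũ`. -/
def mode (h : StateSpace l p) (ξ : ℝ) : OuterSpace m := D.PhiT (D.expB ξ h)

/-- The space `H̃` of the modes of the elements of `Ĥ`. -/
def modeSpace : Set (ℝ → OuterSpace m) := D.mode '' (D.principal : Set (StateSpace l p))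

/-- `⟨φ, ψ⟩ = c` for the scalar product of `H̃`: for `φ = v_h`, `ψ = v_f` with `h, f ∈ Ĥ`,
`⟨v_h, v_f⟩ = lim_{ξ → ∞} (e^{iξB} h, e^{iξB} f) + ∫_0^∞ (σ_B v_h(ξ), v_f(ξ)) dξ`,
the limit of the sum of the two expressions being taken.
The scalar products are linear in the first argument. -/
def HasModeInner (φ ψ : ℝ → OuterSpace m) (c : ℂ) : Prop :=
  ∃ h ∈ D.principal, ∃ f ∈ D.principal, φ = D.mode h ∧ ψ = D.mode f ∧
    Tendsto (fun R : ℝ => inner ℂ (D.expB R f) (D.expB R h)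
      + ∫ ξ in (0 : ℝ)..R, inner ℂ (D.mode f ξ) (D.sigmaB (D.mode h ξ))) atTop (𝓝 c)

/-- `h = Ũ* φ` for the adjoint of `Ũ : Ĥ → H̃`, `Ũ f = v_f`: `h ∈ Ĥ` and
`(h, f) = ⟨φ, Ũ f⟩` for every `f ∈ Ĥ`. -/
def IsAdjointMode (φ : ℝ → OuterSpace m) (h : StateSpace l p) : Prop :=
  h ∈ D.principal ∧ ∀ f ∈ D.principal, D.HasModeInner φ (D.mode f) (inner ℂ f h)

/-- The integral equation at the point `(x, t)`:
`φ(ξ) = -∫_0^∞ Ψ(-2x + ξ + η, -2t) φ(η) dη + Ψ(-2x + ξ, -2t) Φ̃ g` for all `ξ ≥ 0`,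
the integral being convergent as an improper one. -/
def SolvesIntegralEq (b : ℝ) (U ρ : StateSpace l p →L[ℂ] StateSpace l p) (g : StateSpace l p)
    (x t : ℝ) (φ : ℝ → OuterSpace m) : Prop :=
  ∀ ξ : ℝ, 0 ≤ ξ → ∃ J : OuterSpace m,
    Tendsto (fun R : ℝ => ∫ η in (0 : ℝ)..R, D.Psi b U ρ (-2 * x + ξ + η) (-2 * t) (φ η)) atTop
      (𝓝 J) ∧
    φ ξ = -J + D.Psi b U ρ (-2 * x + ξ) (-2 * t) (D.PhiT g)

end TriangularData

end KdVColligation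

end

/-! Put P = iB and M₀ = U*M. The relation B* = -UBU* gives U* T*⁻¹(x,t) = T(-x,-t) U*, so that Γ =
e^θ + e^(-θ) M₀ with θ = xP - tbP³. Such a Γ satisfies the linear equations Γ_xx = P²Γ and Γ_t =
-bP²Γ_x. For S = Γ⁻¹Γ_x and W = Γ⁻¹P²Γ they become S_x = -S² + W, W_x = WS - SW and S_t = b(WS² -
W²). Hence S_xx = -2 S S_x, and the KdV equation reduces to a polynomial identity in two
noncommuting letters S and W (`kdv_identity`).

It remains to show h + Pg = Sg. Let K = U*ρ(B - B*)/i. Then M₀ is the strong integral of e^(ηP) K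
e^(ηP) over [0, ∞), and differentiating the integrand gives PM₀ + M₀P = -K (`sylvester`). The energy
balance of the colligation makes h ↦ v_h isometric, so φ = v_h. Since Φ̃*σ_BΦ̃ = (B - B*)/i, the
integral equation says that h - T(-2x,-2t)(Kg - M₀h) has zero mode on ξ ≥ 0. If only the zero vector
has this property, then Γh = e^(-θ)Kg, and the Sylvester equation turns this into Γ(h + Pg) = Γ_x g.

Injectivity of h ↦ v_h on all of H is complete non-selfadjointness of the model
(`unobservable_eq_bot`), the analytic core. On the unobservable subspace N, B is symmetric and
equals multiplication by w plus a Volterra term in F(w) = ∫_{-l}^w fΠ, and F(l) = 0. The vector k of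
N representing f ↦ F(w₀)_α sees only [-l, w₀], and also only [w₀, l]. Volterra terms do not affect
exponential growth rates, so k is spectrally supported in both intervals, which forces Bk = w₀k.
Eigenvectors for different w₀ are orthogonal while F is continuous in w₀; therefore every k
vanishes, F = 0, and fΠ = 0 almost everywhere. -/

namespace KdVColligation

/-! ### The logarithmic derivative of a superposition of two opposite waves. -/

section SolitonicCombination

variable {𝔸 : Type*} [NormedRing 𝔸] [NormedAlgebra ℝ 𝔸]

/-- The value of the operator KdV expression on the derivatives of `Γ⁻¹ Γ_x` vanishes. -/
lemma kdv_identity (b : ℝ) (S W : 𝔸) :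
    (4 : ℝ) • b • (W * S ^ 2 - W ^ 2)
      + b • ((6 : ℝ) • (-S ^ 2 + W) ^ 2
        + (-2 : ℝ) • ((-S ^ 2 + W) ^ 2 + S * ((-2 : ℝ) • (S * (-S ^ 2 + W))))) = 0 := by
  rw [smul_comm (4 : ℝ) b, ← smul_add]
  convert smul_zero b
  simp only [mul_smul_comm, smul_add, smul_smul]
  have e : (4 : ℝ) • (W * S ^ 2 - W ^ 2) + ((6 : ℝ) • (-S ^ 2 + W) ^ 2
      + ((-2 : ℝ) • (-S ^ 2 + W) ^ 2 + (-2 * -2 : ℝ) • (S * (S * (-S ^ 2 + W)))))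
      = (4 : ℝ) • ((W * S ^ 2 - W ^ 2) + (-S ^ 2 + W) ^ 2 + S * (S * (-S ^ 2 + W))) := by
    module
  rw [e]
  convert smul_zero (4 : ℝ)
  noncomm_ring

/-- The phase factor `exp (x P - t b P³)`. -/
noncomputable def phase (b : ℝ) (P : 𝔸) (x t : ℝ) : 𝔸 :=
  NormedSpace.exp (x • P + t • (-b) • P ^ 3)

variable (b : ℝ) (P M : 𝔸)

lemma phase_zero : phase b P 0 0 = 1 := by
  simp [phase]

lemma commute_phase (x t : ℝ) : Commute P (phase b P x t) := by
  unfold phase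
  refine Commute.exp_right ?_
  exact ((Commute.refl P).smul_right _).add_right
    ((((Commute.refl P).pow_right 3).smul_right _).smul_right _)

variable [CompleteSpace 𝔸]

lemma exp_add_of_commute_real {x y : 𝔸} (h : Commute x y) :
    NormedSpace.exp (x + y) = NormedSpace.exp x * NormedSpace.exp y := by
  let _ : NormedAlgebra ℚ 𝔸 := NormedAlgebra.restrictScalars ℚ ℝ 𝔸
  exact NormedSpace.exp_add_of_commute h

lemma phase_eq_mul (x t : ℝ) :
    phase b P x t = NormedSpace.exp (x • P) * NormedSpace.exp (t • (-b) • P ^ 3) := by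
  refine exp_add_of_commute_real ?_
  exact ((((Commute.refl P).pow_right 3).smul_right _).smul_right _).smul_left _

lemma phase_add (x t y s : ℝ) :
    phase b P (x + y) (t + s) = phase b P x t * phase b P y s := by
  unfold phase
  rw [← exp_add_of_commute_real]
  · congr 1
    module
  · have h : Commute P (P ^ 3) := (Commute.refl P).pow_right 3
    refine Commute.add_left (Commute.add_right ?_ ?_) (Commute.add_right ?_ ?_)
    · exact ((Commute.refl P).smul_right _).smul_left _
    · exact ((h.smul_right _).smul_right _).smul_left _
    · exact ((h.symm.smul_right _).smul_left _).smul_left _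
    · exact ((((Commute.refl (P ^ 3)).smul_right _).smul_right _).smul_left _).smul_left _

lemma hasDerivAt_phase_fst (x t : ℝ) :
    HasDerivAt (fun y => phase b P y t) (P * phase b P x t) x := by
  simp only [phase_eq_mul]
  have := (hasDerivAt_exp_smul_const' (𝕂 := ℝ) P x).mul_const
    (NormedSpace.exp (t • (-b) • P ^ 3))
  simpa [mul_assoc] using this

lemma hasDerivAt_phase_snd (x t : ℝ) :
    HasDerivAt (fun s => phase b P x s) (-b • (P ^ 3 * phase b P x t)) t := by
  have hc : Commute (P ^ 3) (NormedSpace.exp (x • P)) :=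
    Commute.exp_right (((Commute.refl P).pow_left 3).smul_right _)
  simp only [phase_eq_mul]
  have := (hasDerivAt_exp_smul_const' (𝕂 := ℝ) ((-b) • P ^ 3) t).const_mul
    (NormedSpace.exp (x • P))
  refine this.congr_deriv ?_
  rw [smul_mul_assoc, mul_smul_comm, ← mul_assoc, ← mul_assoc, hc.eq]

lemma contDiff_phase : ContDiff ℝ (⊤ : ℕ∞) (fun z : ℝ × ℝ => phase b P z.1 z.2) := by
  have h : ContDiff ℝ (⊤ : ℕ∞) (NormedSpace.exp : 𝔸 → 𝔸) :=
    contDiff_iff_contDiffAt.2 fun x => (NormedSpace.exp_analytic (𝕂 := ℝ) x).contDiffAt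
  exact h.comp ((contDiff_fst.smul contDiff_const).add (contDiff_snd.smul contDiff_const))

/-- The superposition `exp(θ) + exp(-θ) M` of two opposite waves, `θ = x P - t b P³`. -/
noncomputable def twoWave (x t : ℝ) : 𝔸 := phase b P x t + phase b P (-x) (-t) * M

/-- The `x`-derivative of `twoWave`. -/
noncomputable def twoWaveX (x t : ℝ) : 𝔸 :=
  P * (phase b P x t - phase b P (-x) (-t) * M)

lemma hasDerivAt_phase_neg_fst (x t : ℝ) :
    HasDerivAt (fun y => phase b P (-y) (-t)) (-(P * phase b P (-x) (-t))) x := by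
  have := (hasDerivAt_phase_fst b P (-x) (-t)).scomp x (hasDerivAt_neg x)
  simpa [Function.comp_def] using this

lemma hasDerivAt_phase_neg_snd (x t : ℝ) :
    HasDerivAt (fun s => phase b P (-x) (-s)) (b • (P ^ 3 * phase b P (-x) (-t))) t := by
  have := (hasDerivAt_phase_snd b P (-x) (-t)).scomp t (hasDerivAt_neg t)
  simpa [Function.comp_def] using this

lemma hasDerivAt_twoWave_fst (x t : ℝ) :
    HasDerivAt (fun y => twoWave b P M y t) (twoWaveX b P M x t) x := by
  have := (hasDerivAt_phase_fst b P x t).add ((hasDerivAt_phase_neg_fst b P x t).mul_const M)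
  refine this.congr_deriv ?_
  unfold twoWaveX
  noncomm_ring

/-- The opposite signs of the two exponents are squared away, so both waves obey one second order
equation. The factor P² stays on the left and never has to commute with M. -/
lemma hasDerivAt_twoWaveX_fst (x t : ℝ) :
    HasDerivAt (fun y => twoWaveX b P M y t) (P ^ 2 * twoWave b P M x t) x := by
  have := ((hasDerivAt_phase_fst b P x t).sub
    ((hasDerivAt_phase_neg_fst b P x t).mul_const M)).const_mul P
  refine this.congr_deriv ?_
  unfold twoWave
  noncomm_ring

/-- The power P³ is odd, so the two waves acquire the same relative sign in t as in x; this is why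
the t-derivative is a multiple of P² times the x-derivative. -/
lemma hasDerivAt_twoWave_snd (x t : ℝ) :
    HasDerivAt (fun s => twoWave b P M x s) (-b • (P ^ 2 * twoWaveX b P M x t)) t := by
  have := (hasDerivAt_phase_snd b P x t).add ((hasDerivAt_phase_neg_snd b P x t).mul_const M)
  refine this.congr_deriv ?_
  unfold twoWaveX
  simp only [pow_succ, pow_zero, one_mul, mul_sub, smul_sub, mul_assoc, smul_mul_assoc, neg_smul]
  noncomm_ring

lemma hasDerivAt_twoWaveX_snd (x t : ℝ) :
    HasDerivAt (fun s => twoWaveX b P M x s) (-b • (P ^ 4 * twoWave b P M x t)) t := by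
  have := ((hasDerivAt_phase_snd b P x t).sub
    ((hasDerivAt_phase_neg_snd b P x t).mul_const M)).const_mul P
  refine this.congr_deriv ?_
  unfold twoWave
  simp only [pow_succ, pow_zero, one_mul, mul_sub, mul_add, smul_add, mul_assoc, smul_mul_assoc,
    neg_smul, mul_neg, mul_smul_comm]
  noncomm_ring

lemma contDiff_twoWave : ContDiff ℝ (⊤ : ℕ∞) (fun z : ℝ × ℝ => twoWave b P M z.1 z.2) := by
  refine (contDiff_phase b P).add (ContDiff.mul ?_ contDiff_const)
  exact (contDiff_phase b P).comp (contDiff_fst.neg.prodMk contDiff_snd.neg)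

lemma contDiff_twoWaveX : ContDiff ℝ (⊤ : ℕ∞) (fun z : ℝ × ℝ => twoWaveX b P M z.1 z.2) := by
  refine contDiff_const.mul ((contDiff_phase b P).sub (ContDiff.mul ?_ contDiff_const))
  exact (contDiff_phase b P).comp (contDiff_fst.neg.prodMk contDiff_snd.neg)

/-- The logarithmic derivative `Γ⁻¹ Γ_x` of `Γ = twoWave`. -/
noncomputable def logDerivWave (x t : ℝ) : 𝔸 :=
  Ring.inverse (twoWave b P M x t) * twoWaveX b P M x t

/-- The conjugate `Γ⁻¹ P² Γ` of `P²` by `Γ = twoWave`. -/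
noncomputable def conjSq (x t : ℝ) : 𝔸 :=
  Ring.inverse (twoWave b P M x t) * P ^ 2 * twoWave b P M x t

lemma hasDerivAt_ringInverse_comp {f : ℝ → 𝔸} {f' : 𝔸} {x : ℝ} (hf : HasDerivAt f f' x)
    (hu : IsUnit (f x)) :
    HasDerivAt (fun y => Ring.inverse (f y)) (-(Ring.inverse (f x) * f' * Ring.inverse (f x))) x := by
  obtain ⟨u, hu⟩ := hu
  have h := hasFDerivAt_ringInverse (𝕜 := ℝ) u
  rw [hu] at h
  have := h.comp_hasDerivAt x hf
  refine this.congr_deriv ?_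
  simp [← hu]

variable {b P M}

/-- The Riccati form of Γ_xx = P²Γ. -/
lemma hasDerivAt_logDerivWave_fst {x t : ℝ} (hu : IsUnit (twoWave b P M x t)) :
    HasDerivAt (fun y => logDerivWave b P M y t)
      (-(logDerivWave b P M x t) ^ 2 + conjSq b P M x t) x := by
  have := (hasDerivAt_ringInverse_comp (hasDerivAt_twoWave_fst b P M x t) hu).mul
    (hasDerivAt_twoWaveX_fst b P M x t)
  refine this.congr_deriv ?_
  unfold logDerivWave conjSq
  noncomm_ring

lemma hasDerivAt_conjSq_fst {x t : ℝ} (hu : IsUnit (twoWave b P M x t)) :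
    HasDerivAt (fun y => conjSq b P M y t)
      (conjSq b P M x t * logDerivWave b P M x t
        - logDerivWave b P M x t * conjSq b P M x t) x := by
  have := ((hasDerivAt_ringInverse_comp (hasDerivAt_twoWave_fst b P M x t) hu).mul_const
    (P ^ 2)).mul (hasDerivAt_twoWave_fst b P M x t)
  refine this.congr_deriv ?_
  have h : twoWave b P M x t * Ring.inverse (twoWave b P M x t) = 1 :=
    Ring.mul_inverse_cancel _ hu
  unfold logDerivWave conjSq
  -- The product WS hides a factor ΓΓ⁻¹, which must cancel before the two sides agree as words in
  -- the free algebra.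
  have h2 : Ring.inverse (twoWave b P M x t) * P ^ 2 * twoWave b P M x t *
      (Ring.inverse (twoWave b P M x t) * twoWaveX b P M x t)
      = Ring.inverse (twoWave b P M x t) * P ^ 2 *
        (twoWave b P M x t * Ring.inverse (twoWave b P M x t)) * twoWaveX b P M x t := by
    noncomm_ring
  rw [h2, h]
  noncomm_ring

/-- Conjugation is multiplicative, so Γ⁻¹P⁴Γ = W² and the t-derivative closes up in S and W. -/
lemma hasDerivAt_logDerivWave_snd {x t : ℝ} (hu : IsUnit (twoWave b P M x t)) :
    HasDerivAt (fun s => logDerivWave b P M x s)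
      (b • (conjSq b P M x t * (logDerivWave b P M x t) ^ 2 - conjSq b P M x t ^ 2)) t := by
  have := (hasDerivAt_ringInverse_comp (hasDerivAt_twoWave_snd b P M x t) hu).mul
    (hasDerivAt_twoWaveX_snd b P M x t)
  refine this.congr_deriv ?_
  have h : twoWave b P M x t * Ring.inverse (twoWave b P M x t) = 1 :=
    Ring.mul_inverse_cancel _ hu
  have h' : ∀ z : 𝔸, twoWave b P M x t * (Ring.inverse (twoWave b P M x t) * z) = z := by
    intro z; rw [← mul_assoc, h, one_mul]
  unfold logDerivWave conjSq
  simp only [pow_succ, pow_zero, one_mul, mul_assoc, h', smul_mul_assoc, mul_smul_comm,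
    neg_smul, mul_neg, neg_mul, neg_neg, smul_sub]
  abel

/-- The term WS of W_x cancels against the one from -S_x S. What is left is -2 S S_x, so the third
derivative needs only the product rule. -/
lemma hasDerivAt_logDerivWave_fst₂ {x t : ℝ} (hu : IsUnit (twoWave b P M x t)) :
    HasDerivAt (fun y => -(logDerivWave b P M y t) ^ 2 + conjSq b P M y t)
      ((-2 : ℝ) • (logDerivWave b P M x t
        * (-(logDerivWave b P M x t) ^ 2 + conjSq b P M x t))) x := by
  have h1 := hasDerivAt_logDerivWave_fst hu
  have := ((h1.mul h1).neg).add (hasDerivAt_conjSq_fst hu)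
  simp only [pow_two] at this ⊢
  refine this.congr_deriv ?_
  rw [show (-2 : ℝ) = -1 + -1 by norm_num, add_smul]
  simp only [neg_smul, one_smul]
  noncomm_ring

lemma hasDerivAt_logDerivWave_fst₃ {x t : ℝ} (hu : IsUnit (twoWave b P M x t)) :
    HasDerivAt (fun y => (-2 : ℝ) • (logDerivWave b P M y t
        * (-(logDerivWave b P M y t) ^ 2 + conjSq b P M y t)))
      ((-2 : ℝ) • ((-(logDerivWave b P M x t) ^ 2 + conjSq b P M x t) ^ 2
        + logDerivWave b P M x t * ((-2 : ℝ) • (logDerivWave b P M x t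
        * (-(logDerivWave b P M x t) ^ 2 + conjSq b P M x t))))) x := by
  have := ((hasDerivAt_logDerivWave_fst hu).mul (hasDerivAt_logDerivWave_fst₂ hu)).const_smul
    (-2 : ℝ)
  refine this.congr_deriv ?_
  rw [pow_two (-(logDerivWave b P M x t) ^ 2 + conjSq b P M x t)]

lemma contDiffAt_logDerivWave {x t : ℝ} (hu : IsUnit (twoWave b P M x t)) :
    ContDiffAt ℝ (⊤ : ℕ∞) (fun z : ℝ × ℝ => logDerivWave b P M z.1 z.2) (x, t) := by
  refine ContDiffAt.mul ?_ (contDiff_twoWaveX b P M).contDiffAt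
  obtain ⟨u, hu⟩ := hu
  have h := contDiffAt_ringInverse (n := (⊤ : ℕ∞)) ℝ u
  rw [hu] at h
  exact ContDiffAt.comp (x, t) (f := fun z : ℝ × ℝ => twoWave b P M z.1 z.2) h
    (contDiff_twoWave b P M).contDiffAt

end SolitonicCombination

lemma iteratedDeriv_three_of_hasDerivAt {F : Type*} [NormedAddCommGroup F] [NormedSpace ℝ F]
    {f f₁ f₂ : ℝ → F} {f₃ : F} {x : ℝ} (h₁ : ∀ᶠ y in 𝓝 x, HasDerivAt f (f₁ y) y)
    (h₂ : ∀ᶠ y in 𝓝 x, HasDerivAt f₁ (f₂ y) y) (h₃ : HasDerivAt f₂ f₃ x) :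
    iteratedDeriv 3 f x = f₃ := by
  have e₁ : deriv f =ᶠ[𝓝 x] f₁ := h₁.mono fun y hy => hy.deriv
  have e₂ : deriv f₁ =ᶠ[𝓝 x] f₂ := h₂.mono fun y hy => hy.deriv
  rw [iteratedDeriv_succ, iteratedDeriv_succ, iteratedDeriv_one,
    ((e₁.deriv).trans e₂).deriv_eq, h₃.deriv]

/-! ### Volterra recursions and integration by parts. -/

/-- A sequence of functions controlled by a Volterra type recursion grows no faster than the powers
of any number above the multiplication constant `R`. -/
lemma exists_integral_le_of_volterra {α : Type*} [MeasurableSpace α] {μ : Measure α}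
    {a : ℕ → α → ℝ} {s : α → Set α} {E : α → ℝ} {R K δ : ℝ} (hR : 0 ≤ R) (hK : 0 ≤ K)
    (hδ : 0 < δ) (ha : ∀ n, Integrable (a n) μ) (ha₀ : ∀ n w, 0 ≤ a n w)
    (hE : Integrable E μ) (hE₁ : ∀ᵐ w ∂μ, 1 ≤ E w)
    (hsE : ∀ᵐ w ∂μ, ∫ x in s w, E x ∂μ ≤ δ * E w)
    (hrec : ∀ n, ∀ᵐ w ∂μ, a (n + 1) w ≤ R * a n w + K * ∫ x in s w, a n x ∂μ) :
    ∃ C, ∀ n, ∫ x, a n x ∂μ ≤ C * (R + 2 * K * δ) ^ n := by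
  set r := R + 2 * K * δ with hr
  have hRr : R ≤ r := by rw [hr]; nlinarith [mul_nonneg hK hδ.le]
  set I := ∫ x, a 0 x ∂μ with hI
  have hI₀ : 0 ≤ I := integral_nonneg (ha₀ 0)
  -- Induction with the weight E as a Bielecki majorant. Of the 2Kδ by which r exceeds R, one Kδ
  -- pays for the integral of E, the other for the integral of a 0, which is at most I ≤ I E.
  have key : ∀ n, ∀ᵐ w ∂μ, a n w ≤ R ^ n * a 0 w + I / δ * r ^ n * E w := by
    intro n
    induction n with
    | zero =>
      filter_upwards [hE₁] with w hw
      simp only [pow_zero, one_mul, mul_one]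
      have : 0 ≤ I / δ * E w := by positivity
      linarith
    | succ n ih =>
      filter_upwards [ih, hsE, hrec n, hE₁] with w h1 h2 h3 hE'
      have h4 : ∫ x in s w, a n x ∂μ ≤ R ^ n * I + I / δ * r ^ n * (δ * E w) := by
        calc ∫ x in s w, a n x ∂μ
            ≤ ∫ x in s w, (R ^ n * a 0 x + I / δ * r ^ n * E x) ∂μ := by
              refine integral_mono_ae (ha n).restrict
                (((ha 0).const_mul _).add (hE.const_mul _)).restrict (ae_restrict_of_ae ih)
          _ = R ^ n * ∫ x in s w, a 0 x ∂μ + I / δ * r ^ n * ∫ x in s w, E x ∂μ := by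
              rw [integral_add ((ha 0).const_mul _).restrict (hE.const_mul _).restrict,
                integral_const_mul, integral_const_mul]
          _ ≤ _ := by
              have : ∫ x in s w, a 0 x ∂μ ≤ I :=
                setIntegral_le_integral (ha 0) (Eventually.of_forall (ha₀ 0))
              gcongr
      have hrn : R ^ n ≤ r ^ n := pow_le_pow_left₀ hR hRr n
      have e : I / δ * r ^ (n + 1) * E w = R * (I / δ * r ^ n * E w)
          + K * (I * r ^ n * E w) + K * (I * r ^ n * E w) := by
        rw [pow_succ, hr]; field_simp; ring
      have e2 : I / δ * r ^ n * (δ * E w) = I * r ^ n * E w := by field_simp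
      have h5 : R ^ n * I ≤ I * r ^ n * E w := by
        have h6 : 0 ≤ I * r ^ n := mul_nonneg hI₀ ((pow_nonneg hR n).trans hrn)
        nlinarith
      calc a (n + 1) w ≤ R * (R ^ n * a 0 w + I / δ * r ^ n * E w)
            + K * (I * r ^ n * E w + I * r ^ n * E w) := by
            refine h3.trans ?_
            gcongr
            linarith
        _ = _ := by rw [e]; ring
  refine ⟨I + I / δ * ∫ x, E x ∂μ, fun n => ?_⟩
  calc ∫ x, a n x ∂μ ≤ ∫ x, (R ^ n * a 0 x + I / δ * r ^ n * E x) ∂μ :=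
        integral_mono_ae (ha n) (((ha 0).const_mul _).add (hE.const_mul _)) (key n)
    _ = R ^ n * I + I / δ * r ^ n * ∫ x, E x ∂μ := by
        rw [integral_add ((ha 0).const_mul _) (hE.const_mul _), integral_const_mul,
          integral_const_mul]
    _ ≤ r ^ n * I + I / δ * r ^ n * ∫ x, E x ∂μ := by gcongr
    _ = _ := by ring

/-- Integration by parts for primitives of integrable functions. -/
lemma integral_mul_primitive_add {u v : ℝ → ℂ} {a b : ℝ} (hab : a ≤ b)
    (hu : IntegrableOn u (Set.Ioc a b)) (hv : IntegrableOn v (Set.Ioc a b)) :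
    (∫ x in a..b, u x * ∫ y in a..x, v y) + (∫ y in a..b, (∫ x in a..y, u x) * v y)
      = (∫ x in a..b, u x) * ∫ y in a..b, v y := by
  set μ := (volume : Measure ℝ).restrict (Set.Ioc a b) with hμ
  have hint : Integrable (fun z : ℝ × ℝ => u z.1 * v z.2) (μ.prod μ) := Integrable.mul_prod hu hv
  have hs : MeasurableSet {z : ℝ × ℝ | z.2 ≤ z.1} := measurableSet_le measurable_snd measurable_fst
  -- Fubini on the square, cut along the diagonal: each triangle gives one of the iterated
  -- integrals.
  have e := integral_add_compl hs hint
  rw [integral_prod_mul u v, ← integral_indicator hs, ← integral_indicator hs.compl,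
    integral_prod _ (hint.indicator hs), integral_prod_symm _ (hint.indicator hs.compl)] at e
  rw [intervalIntegral.integral_of_le hab, intervalIntegral.integral_of_le hab,
    intervalIntegral.integral_of_le hab, intervalIntegral.integral_of_le hab, ← e]
  congr 1
  · refine setIntegral_congr_fun measurableSet_Ioc fun x hx => ?_
    have : (fun y => Set.indicator {z : ℝ × ℝ | z.2 ≤ z.1} (fun z => u z.1 * v z.2) (x, y))
        = fun y => u x * Set.indicator (Set.Iic x) v y := by
      funext y
      by_cases h : y ≤ x <;> simp [Set.indicator, h]
    simp only [this]
    rw [integral_const_mul, integral_indicator measurableSet_Iic, hμ,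
      Measure.restrict_restrict measurableSet_Iic, intervalIntegral.integral_of_le hx.1.le]
    congr 3
    ext y
    simp only [Set.mem_inter_iff, Set.mem_Iic, Set.mem_Ioc]
    exact ⟨fun h => ⟨h.2, h.1, h.2.trans hx.2⟩, fun h => ⟨h.2.1, h.1⟩⟩
  · refine setIntegral_congr_fun measurableSet_Ioc fun y hy => ?_
    have : (fun x => Set.indicator {z : ℝ × ℝ | z.2 ≤ z.1}ᶜ (fun z => u z.1 * v z.2) (x, y))
        = fun x => Set.indicator (Set.Iio y) u x * v y := by
      funext x
      by_cases h : x < y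
      · simp [Set.indicator, h]
      · simp [Set.indicator, h, not_lt.1 h]
    simp only [this]
    rw [integral_mul_const, integral_indicator measurableSet_Iio, hμ,
      Measure.restrict_restrict measurableSet_Iio, intervalIntegral.integral_of_le hy.1.le,
      integral_Ioc_eq_integral_Ioo]
    congr 3
    ext x
    simp only [Set.mem_inter_iff, Set.mem_Iio, Set.mem_Ioc, Set.mem_Ioo]
    exact ⟨fun h => ⟨h.2, h.1, h.2.le.trans hy.2⟩, fun h => ⟨h.2.1, h.1⟩⟩

/-! ### Moment growth of a symmetric operator on an invariant subspace. -/

section SymmetricOn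

variable {H : Type*} [NormedAddCommGroup H] [InnerProductSpace ℂ H]
  {N : Submodule ℂ H} {T : H →L[ℂ] H}

local notation "⟪" x ", " y "⟫" => inner ℂ x y

lemma pow_apply_mem (hN : ∀ f ∈ N, T f ∈ N) {f : H} (hf : f ∈ N) (n : ℕ) : (T ^ n) f ∈ N := by
  induction n with
  | zero => simpa
  | succ n ih => rw [pow_succ']; exact hN _ ih

lemma inner_pow_apply_left (hN : ∀ f ∈ N, T f ∈ N)
    (hT : ∀ f ∈ N, ∀ g ∈ N, ⟪T f, g⟫ = ⟪f, T g⟫) {f g : H} (hf : f ∈ N) (hg : g ∈ N) (n : ℕ) :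
    ⟪(T ^ n) f, g⟫ = ⟪f, (T ^ n) g⟫ := by
  induction n generalizing g with
  | zero => simp
  | succ n ih =>
    rw [pow_succ', mul_apply_eq_comp, hT _ (pow_apply_mem hN hf n) _ hg,
      ih (hN _ hg), ← mul_apply_eq_comp, ← pow_succ, pow_succ']

/-- The spectral radius of a vector bounds the operator on it, for symmetric operators. -/
lemma norm_apply_le_of_norm_inner_pow_le (hN : ∀ f ∈ N, T f ∈ N)
    (hT : ∀ f ∈ N, ∀ g ∈ N, ⟪T f, g⟫ = ⟪f, T g⟫) {k : H} (hk : k ∈ N) {C r : ℝ} (hr : 0 ≤ r)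
    (hC : ∀ n : ℕ, ‖⟪k, (T ^ n) k⟫‖ ≤ C * r ^ n) : ‖T k‖ ≤ r * ‖k‖ := by
  by_contra! hlt
  have hk₀ : 0 < ‖k‖ := by
    rw [norm_pos_iff]
    rintro rfl
    simp at hlt
  have hsq : ∀ n, ‖(T ^ n) k‖ ^ 2 ≤ C * (r ^ 2) ^ n := by
    intro n
    have h1 : ⟪(T ^ n) k, (T ^ n) k⟫ = ⟪k, (T ^ (2 * n)) k⟫ := by
      rw [inner_pow_apply_left hN hT hk (pow_apply_mem hN hk n), two_mul, pow_add]; rfl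
    have h2 : ‖(T ^ n) k‖ ^ 2 = ‖⟪(T ^ n) k, (T ^ n) k⟫‖ := by
      rw [inner_self_eq_norm_sq_to_K]; simp
    rw [h2, h1, ← pow_mul]
    exact hC _
  -- The norms of Tⁿk are log-convex, so the ratio q of the first two persists. If q exceeded r, the
  -- growth qⁿ would contradict the bound on the even moments.
  have hconv : ∀ n, ‖(T ^ (n + 1)) k‖ ^ 2 ≤ ‖(T ^ n) k‖ * ‖(T ^ (n + 2)) k‖ := by
    intro n
    have h1 : ⟪(T ^ (n + 1)) k, (T ^ (n + 1)) k⟫ = ⟪(T ^ n) k, (T ^ (n + 2)) k⟫ := by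
      conv_lhs => enter [2]; rw [pow_succ', mul_apply_eq_comp]
      rw [hT _ (pow_apply_mem hN hk n) _ (pow_apply_mem hN hk _),
        ← mul_apply_eq_comp, ← pow_succ']
    have h2 : ‖(T ^ (n + 1)) k‖ ^ 2 = ‖⟪(T ^ (n + 1)) k, (T ^ (n + 1)) k⟫‖ := by
      rw [inner_self_eq_norm_sq_to_K]; simp
    rw [h2, h1]
    exact norm_inner_le_norm _ _
  set q := ‖T k‖ / ‖k‖ with hq
  have hrq : r < q := by rwa [hq, lt_div_iff₀ hk₀]
  have hq₀ : 0 < q := hr.trans_lt hrq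
  have hgrow : ∀ n, 0 < ‖(T ^ n) k‖ ∧ q * ‖(T ^ n) k‖ ≤ ‖(T ^ (n + 1)) k‖ := by
    intro n
    induction n with
    | zero =>
      refine ⟨by simpa using hk₀, le_of_eq ?_⟩
      rw [hq]; simp; field_simp
    | succ n ih =>
      have h1 : 0 < ‖(T ^ (n + 1)) k‖ := (mul_pos hq₀ ih.1).trans_le ih.2
      refine ⟨h1, ?_⟩
      have h2 := hconv n
      have h3 : ‖(T ^ n) k‖ * (q * ‖(T ^ (n + 1)) k‖) ≤ ‖(T ^ n) k‖ * ‖(T ^ (n + 2)) k‖ := by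
        nlinarith [ih.2]
      exact le_of_mul_le_mul_left h3 ih.1
  have hpow : ∀ n, q ^ n * ‖k‖ ≤ ‖(T ^ n) k‖ := by
    intro n
    induction n with
    | zero => simp
    | succ n ih =>
      calc q ^ (n + 1) * ‖k‖ = q * (q ^ n * ‖k‖) := by ring
        _ ≤ q * ‖(T ^ n) k‖ := by gcongr
        _ ≤ _ := (hgrow n).2
  have hlim : Tendsto (fun n : ℕ => C * (r ^ 2 / q ^ 2) ^ n) atTop (𝓝 (C * 0)) := by
    refine (tendsto_pow_atTop_nhds_zero_of_lt_one (by positivity) ?_).const_mul C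
    rw [div_lt_one (by positivity)]
    exact pow_lt_pow_left₀ hrq hr two_ne_zero
  have hle : ‖k‖ ^ 2 ≤ C * 0 := by
    refine ge_of_tendsto' hlim fun n => ?_
    have h1 : (q ^ n * ‖k‖) ^ 2 ≤ C * (r ^ 2) ^ n :=
      (pow_le_pow_left₀ (by positivity) (hpow n) 2).trans (hsq n)
    rw [div_pow, ← mul_div_assoc, le_div_iff₀ (by positivity)]
    calc ‖k‖ ^ 2 * (q ^ 2) ^ n = (q ^ n * ‖k‖) ^ 2 := by ring
      _ ≤ _ := h1
  nlinarith [sq_pos_of_pos hk₀]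

end SymmetricOn

lemma coeFn_mulVar (l : ℝ) (p : ℕ) (f : StateSpace l p) :
    mulVar l p f =ᵐ[volume.restrict (Set.Icc (-l) l)] fun w => (w : ℂ) • f w :=
  MemLp.coeFn_toLp (memLp_mulVar l p f)

lemma inner_mulVar {l : ℝ} {p : ℕ} (f g : StateSpace l p) :
    inner ℂ f (mulVar l p g) = inner ℂ (mulVar l p f) g := by
  rw [L2.inner_def, L2.inner_def]
  refine integral_congr_ae ?_
  filter_upwards [coeFn_mulVar l p f, coeFn_mulVar l p g] with w hf hg
  rw [hf, hg, inner_smul_left, inner_smul_right, Complex.conj_ofReal]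

/-! ### Quadratic form of the model and the colligation condition. -/

namespace TriangularData

variable {l : ℝ} {p m r : ℕ} (D : TriangularData l p m r)

lemma neg_l_mem (D : TriangularData l p m r) : -l ∈ Set.Icc (-l) l := ⟨le_rfl, by linarith [D.l_pos]⟩

lemma l_mem (D : TriangularData l p m r) : l ∈ Set.Icc (-l) l := ⟨by linarith [D.l_pos], le_rfl⟩

lemma coeFn_kernelOp (f : StateSpace l p) :
    D.kernelOp f =ᵐ[volume.restrict (Set.Icc (-l) l)] D.kernelFun f :=
  MemLp.coeFn_toLp (D.memLp_kernelFun f)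

lemma coeFn_B (f : StateSpace l p) :
    D.B f =ᵐ[volume.restrict (Set.Icc (-l) l)] fun w => (w : ℂ) • f w + D.kernelFun f w := by
  filter_upwards [coeFn_mulVar l p f, D.coeFn_kernelOp f,
    Lp.coeFn_add (mulVar l p f) (D.kernelOp f)] with w h1 h2 h3
  change (mulVar l p f + D.kernelOp f : StateSpace l p) w = _
  rw [h3, Pi.add_apply, h1, h2]

lemma rowIntegral_add_adjacent (f : StateSpace l p) {w : ℝ} (hw : w ∈ Set.Icc (-l) l) :
    D.rowIntegral f (-l) w + D.rowIntegral f w l = D.rowIntegral f (-l) l :=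
  intervalIntegral.integral_add_adjacent_intervals
    (D.intervalIntegrable_row f D.neg_l_mem hw) (D.intervalIntegrable_row f hw D.l_mem)

/-- The kernel expressed through the primitive of `f Π` and the total integral of `f Π`. -/
lemma kernelFun_eq (f : StateSpace l p) {w : ℝ} (hw : w ∈ Set.Icc (-l) l) :
    D.kernelFun f w = WithLp.toLp 2 (Complex.I •
      ((D.rowIntegral f (-l) w ᵥ* (J₁ m r - J₂ m r) + D.rowIntegral f (-l) l ᵥ* D.S)
        ᵥ* (D.PiM w)ᴴ)) := by
  unfold kernelFun L
  -- The S* of L cancels the first integral; the S of L completes the second one to the whole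
  -- interval.
  rw [← D.rowIntegral_add_adjacent f hw]
  congr 1
  simp only [Matrix.add_vecMul, Matrix.vecMul_add, smul_add, neg_smul, Matrix.vecMul_sub]
  abel

lemma rowIntegral_apply (f : StateSpace l p) {a c : ℝ} (ha : a ∈ Set.Icc (-l) l)
    (hc : c ∈ Set.Icc (-l) l) (α : Fin m) :
    D.rowIntegral f a c α = ∫ ξ in a..c, ((f ξ).ofLp ᵥ* D.PiM ξ) α := by
  have := (ContinuousLinearMap.proj (R := ℂ) (φ := fun _ : Fin m => ℂ) α).intervalIntegral_comp_comm
    (D.intervalIntegrable_row f ha hc)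
  simpa [rowIntegral] using this.symm

lemma inner_channel (f : StateSpace l p) (α : Fin m) :
    inner ℂ (D.channel α) f = D.rowIntegral f (-l) l α := by
  rw [D.rowIntegral_apply f D.neg_l_mem D.l_mem, L2.inner_def,
    intervalIntegral.integral_of_le D.l_mem.1, ← integral_Icc_eq_integral_Ioc]
  refine integral_congr_ae ?_
  filter_upwards [MemLp.coeFn_toLp (D.memLp_channelFun α)] with w hw
  have h : D.channel α w = D.channelFun α w := hw
  rw [h]
  simp [channelFun, PiLp.inner_apply, Matrix.vecMul, dotProduct]

lemma inner_toLp_vecMul (x : EuclideanSpace ℂ (Fin p)) (v : Fin m → ℂ)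
    (A : Matrix (Fin p) (Fin m) ℂ) :
    inner ℂ x (WithLp.toLp 2 (v ᵥ* Aᴴ) : EuclideanSpace ℂ (Fin p))
      = ∑ β, v β * star ((x.ofLp ᵥ* A) β) := by
  simp only [PiLp.inner_apply, Matrix.vecMul, dotProduct, Matrix.conjTranspose_apply, star_sum,
    star_mul', RCLike.inner_apply, Finset.mul_sum, Finset.sum_mul]
  rw [Finset.sum_comm]
  refine Finset.sum_congr rfl fun β _ => Finset.sum_congr rfl fun i _ => ?_
  simp
  ring

/-- The diagonal entries of `J₁ - J₂`. -/
lemma vecMul_J (v : Fin m → ℂ) (β : Fin m) :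
    (v ᵥ* (J₁ m r - J₂ m r)) β = (if (β : ℕ) < r then 1 else -1) * v β := by
  rw [Matrix.vecMul_sub, Pi.sub_apply, J₁, J₂, Matrix.vecMul_diagonal, Matrix.vecMul_diagonal]
  split_ifs <;> ring

lemma integrableOn_row_apply (f : StateSpace l p) (β : Fin m) :
    IntegrableOn (fun ξ => ((f ξ).ofLp ᵥ* D.PiM ξ) β) (Set.Icc (-l) l) :=
  (ContinuousLinearMap.proj (R := ℂ) (φ := fun _ : Fin m => ℂ) β).integrable_comp
    (D.integrableOn_row f)

lemma integrableOn_star_row_apply (f : StateSpace l p) (β : Fin m) :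
    IntegrableOn (fun ξ => star (((f ξ).ofLp ᵥ* D.PiM ξ) β)) (Set.Icc (-l) l) :=
  (Complex.conjCLE : ℂ →L[ℝ] ℂ).integrable_comp (D.integrableOn_row_apply f β)

lemma integrableOn_rowIntegral_mul (f g : StateSpace l p) (β : Fin m) :
    IntegrableOn (fun w => D.rowIntegral g (-l) w β * star (((f w).ofLp ᵥ* D.PiM w) β))
      (Set.Icc (-l) l) :=
  (D.integrableOn_star_row_apply f β).continuousOn_mul
    ((continuous_apply β).comp_continuousOn (D.continuousOn_rowIntegral_left g)) isCompact_Icc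

lemma inner_kernelOp (f g : StateSpace l p) :
    inner ℂ f (D.kernelOp g) = Complex.I *
      ∑ β : Fin m, ((if (β : ℕ) < r then 1 else -1) * (∫ w in (-l)..l,
          D.rowIntegral g (-l) w β * star (((f w).ofLp ᵥ* D.PiM w) β))
        + (D.rowIntegral g (-l) l ᵥ* D.S) β * star (D.rowIntegral f (-l) l β)) := by
  have h : inner ℂ f (D.kernelOp g) = ∫ w in Set.Icc (-l) l, Complex.I * ∑ β : Fin m,
      ((if (β : ℕ) < r then 1 else -1) *
          (D.rowIntegral g (-l) w β * star (((f w).ofLp ᵥ* D.PiM w) β))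
        + (D.rowIntegral g (-l) l ᵥ* D.S) β * star (((f w).ofLp ᵥ* D.PiM w) β)) := by
    rw [L2.inner_def]
    refine integral_congr_ae ?_
    filter_upwards [D.coeFn_kernelOp g, ae_restrict_mem measurableSet_Icc] with w hw hm
    rw [hw, D.kernelFun_eq g hm, WithLp.toLp_smul, inner_smul_right, inner_toLp_vecMul]
    congr 1
    refine Finset.sum_congr rfl fun β _ => ?_
    rw [Pi.add_apply, vecMul_J]
    ring
  have hi₁ := fun β : Fin m => (D.integrableOn_rowIntegral_mul f g β).const_mul
    (if (β : ℕ) < r then 1 else -1)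
  have hi₂ := fun β : Fin m => (D.integrableOn_star_row_apply f β).const_mul
    ((D.rowIntegral g (-l) l ᵥ* D.S) β)
  rw [h, integral_const_mul, integral_finsetSum _ fun β _ => (hi₁ β).fun_add (hi₂ β)]
  congr 1
  refine Finset.sum_congr rfl fun β _ => ?_
  rw [integral_add (hi₁ β) (hi₂ β), integral_const_mul, integral_const_mul,
    D.rowIntegral_apply f D.neg_l_mem D.l_mem, intervalIntegral.integral_of_le D.l_mem.1,
    intervalIntegral.integral_of_le D.l_mem.1, ← integral_Icc_eq_integral_Ioc,
    ← integral_Icc_eq_integral_Ioc]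
  congr 2
  exact integral_conj

/-- The form of the imaginary part of the kernel operator. -/
lemma inner_kernelOp_sub (f g : StateSpace l p) :
    inner ℂ f (D.kernelOp g) - inner ℂ (D.kernelOp f) g = Complex.I *
      ∑ β, (D.rowIntegral g (-l) l ᵥ* D.L) β * star (D.rowIntegral f (-l) l β) := by
  have hconj : inner ℂ (D.kernelOp f) g = star (inner ℂ g (D.kernelOp f)) :=
    (inner_conj_symm _ _).symm
  -- The diagonal signs ±1 are real, so the Volterra part and its adjoint combine by parts into a
  -- boundary term of total integrals only.
  have hparts : ∀ β : Fin m, (∫ w in (-l)..l,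
      D.rowIntegral g (-l) w β * star (((f w).ofLp ᵥ* D.PiM w) β))
      + star (∫ w in (-l)..l, D.rowIntegral f (-l) w β * star (((g w).ofLp ᵥ* D.PiM w) β))
      = D.rowIntegral g (-l) l β * star (D.rowIntegral f (-l) l β) := by
    intro β
    have h := integral_mul_primitive_add D.l_mem.1
      ((D.integrableOn_row_apply g β).mono_set Set.Ioc_subset_Icc_self)
      ((D.integrableOn_star_row_apply f β).mono_set Set.Ioc_subset_Icc_self)
    have hstar : ∀ x : ℝ, x ∈ Set.Icc (-l) l →
        ∫ y in (-l)..x, star (((f y).ofLp ᵥ* D.PiM y) β) = star (D.rowIntegral f (-l) x β) := by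
      intro x hx
      rw [D.rowIntegral_apply f D.neg_l_mem hx, intervalIntegral.integral_of_le hx.1,
        intervalIntegral.integral_of_le hx.1]
      exact integral_conj
    have hI : Set.uIcc (-l) l = Set.Icc (-l) l := Set.uIcc_of_le D.l_mem.1
    have e1 : star (∫ w in (-l)..l,
        D.rowIntegral f (-l) w β * star (((g w).ofLp ᵥ* D.PiM w) β))
        = ∫ x in (-l)..l, ((g x).ofLp ᵥ* D.PiM x) β
          * ∫ y in (-l)..x, star (((f y).ofLp ᵥ* D.PiM y) β) := by
      rw [intervalIntegral.integral_of_le D.l_mem.1, intervalIntegral.integral_of_le D.l_mem.1]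
      refine (integral_conj (𝕜 := ℂ)).symm.trans ?_
      refine setIntegral_congr_fun measurableSet_Ioc fun x hx => ?_
      simp only
      rw [hstar x ⟨hx.1.le, hx.2⟩]
      simp [mul_comm]
    have e2 : (∫ w in (-l)..l,
        D.rowIntegral g (-l) w β * star (((f w).ofLp ᵥ* D.PiM w) β))
        = ∫ y in (-l)..l, (∫ x in (-l)..y, ((g x).ofLp ᵥ* D.PiM x) β)
          * star (((f y).ofLp ᵥ* D.PiM y) β) := by
      refine intervalIntegral.integral_congr fun y hy => ?_
      rw [hI] at hy
      simp only
      rw [D.rowIntegral_apply g D.neg_l_mem hy]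
    rw [e1, e2, add_comm]
    refine h.trans ?_
    rw [hstar l D.l_mem, D.rowIntegral_apply g D.neg_l_mem D.l_mem]
  have hS : ∀ v u : Fin m → ℂ, star (∑ β, (u ᵥ* D.S) β * star (v β))
      = ∑ β, (v ᵥ* D.Sᴴ) β * star (u β) := by
    intro v u
    simp only [Matrix.vecMul, dotProduct, star_sum, star_mul', star_star, Finset.sum_mul,
      Matrix.conjTranspose_apply]
    rw [Finset.sum_comm]
    refine Finset.sum_congr rfl fun β _ => Finset.sum_congr rfl fun i _ => ?_
    ring
  rw [hconj, D.inner_kernelOp f g, D.inner_kernelOp g f, star_mul', Finset.sum_add_distrib,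
    Finset.sum_add_distrib, star_add, hS]
  have hL : ∀ β, (D.rowIntegral g (-l) l ᵥ* D.L) β * star (D.rowIntegral f (-l) l β)
      = (if (β : ℕ) < r then 1 else -1) * (D.rowIntegral g (-l) l β
        * star (D.rowIntegral f (-l) l β))
        + (D.rowIntegral g (-l) l ᵥ* D.S) β * star (D.rowIntegral f (-l) l β)
        + (D.rowIntegral g (-l) l ᵥ* D.Sᴴ) β * star (D.rowIntegral f (-l) l β) := by
    intro β
    rw [L, Matrix.vecMul_add, Matrix.vecMul_add, Pi.add_apply, Pi.add_apply, vecMul_J]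
    ring
  simp only [hL, Finset.sum_add_distrib, ← hparts, mul_add]
  have hI : star Complex.I = -Complex.I := Complex.conj_I
  have hs : star (∑ β : Fin m, (if (β : ℕ) < r then 1 else -1) * ∫ w in (-l)..l,
      D.rowIntegral f (-l) w β * star (((g w).ofLp ᵥ* D.PiM w) β))
      = ∑ β : Fin m, (if (β : ℕ) < r then 1 else -1) * star (∫ w in (-l)..l,
      D.rowIntegral f (-l) w β * star (((g w).ofLp ᵥ* D.PiM w) β)) := by
    rw [star_sum]
    refine Finset.sum_congr rfl fun β _ => ?_
    rw [star_mul']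
    congr 1
    split_ifs <;> simp
  rw [hI, hs]
  ring

lemma PhiT_apply (f : StateSpace l p) (x : Fin 3 × Fin m) :
    D.PhiT f x = inner ℂ ((D.B ^ (x.1 : ℕ)) (D.channel x.2)) f := rfl

lemma sigmaB_apply (v : OuterSpace m) (x : Fin 3 × Fin m) :
    D.sigmaB v x = if x.1 = 0 then ((fun α => v (0, α)) ᵥ* D.L) x.2 else 0 := by
  have : D.sigmaB v x = ∑ y : Fin 3 × Fin m,
      (if x.1 = 0 ∧ y.1 = 0 then D.L y.2 x.2 else 0) * v y := rfl
  rw [this, Fintype.sum_prod_type, Fin.sum_univ_three]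
  by_cases h : x.1 = 0
  · simp [h, Matrix.vecMul, dotProduct, mul_comm]
  · simp [h]

/-- The colligation condition `(B - B*) / i = Φ̃* σ_B Φ̃`. -/
lemma imB_eq : D.imB = ContinuousLinearMap.adjoint D.PhiT ∘L D.sigmaB ∘L D.PhiT := by
  refine ContinuousLinearMap.ext fun g => ext_inner_left ℂ fun f => ?_
  have h1 : inner ℂ f (D.imB g) = ∑ β, (D.rowIntegral g (-l) l ᵥ* D.L) β
      * star (D.rowIntegral f (-l) l β) := by
    have h := D.inner_kernelOp_sub f g
    have e : inner ℂ f (D.imB g) = Complex.I⁻¹ *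
        (inner ℂ f (D.kernelOp g) - inner ℂ (D.kernelOp f) g) := by
      simp only [imB, smul_apply, sub_apply,
        inner_smul_right, inner_sub_right, ContinuousLinearMap.adjoint_inner_right]
      simp only [B, add_apply, inner_add_right, inner_add_left, inner_mulVar]
      ring
    rw [e, h, ← mul_assoc, inv_mul_cancel₀ Complex.I_ne_zero, one_mul]
  have hΦ : ∀ (f : StateSpace l p) (α : Fin m), D.PhiT f (0, α) = D.rowIntegral f (-l) l α :=
    fun f α => by rw [PhiT_apply, ← inner_channel]; simp
  rw [h1, ContinuousLinearMap.comp_apply, ContinuousLinearMap.adjoint_inner_right,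
    PiLp.inner_apply, Fintype.sum_prod_type, Fin.sum_univ_three]
  have z : ∀ (j : Fin 3), j ≠ 0 → ∀ β : Fin m,
      inner ℂ (D.PhiT f (j, β)) ((D.sigmaB ∘L D.PhiT) g (j, β)) = 0 := by
    intro j hj β
    rw [ContinuousLinearMap.comp_apply, sigmaB_apply, if_neg hj, inner_zero_right]
  rw [Finset.sum_eq_zero fun β _ => z 1 (by decide) β,
    Finset.sum_eq_zero fun β _ => z 2 (by decide) β, add_zero, add_zero]
  refine Finset.sum_congr rfl fun β _ => ?_
  rw [ContinuousLinearMap.comp_apply, sigmaB_apply, if_pos rfl, hΦ]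
  have : (fun α => D.PhiT g (0, α)) = D.rowIntegral g (-l) l := funext fun α => hΦ g α
  rw [this]
  rfl

end TriangularData

/-! ### Complete non-selfadjointness of the triangular model. -/

namespace TriangularData

variable {l : ℝ} {p m r : ℕ} (D : TriangularData l p m r)

/-- The unobservable subspace: the vectors all of whose orbit under `B` is killed by `Φ̃`. -/
noncomputable def unobservable : Submodule ℂ (StateSpace l p) :=
  ⨅ n : ℕ, LinearMap.ker (D.PhiT ∘L D.B ^ n).toLinearMap

lemma mem_unobservable {f : StateSpace l p} :
    f ∈ D.unobservable ↔ ∀ n : ℕ, D.PhiT ((D.B ^ n) f) = 0 := by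
  rw [unobservable, Submodule.mem_iInf]
  rfl

lemma isClosed_unobservable : IsClosed (D.unobservable : Set (StateSpace l p)) := by
  rw [unobservable, Submodule.coe_iInf]
  exact isClosed_iInter fun n => (D.PhiT ∘L D.B ^ n).isClosed_ker

lemma B_mem_unobservable {f : StateSpace l p} (hf : f ∈ D.unobservable) :
    D.B f ∈ D.unobservable := by
  rw [mem_unobservable] at hf ⊢
  intro n
  rw [← mul_apply_eq_comp, ← pow_succ]
  exact hf (n + 1)

lemma rowIntegral_eq_zero {f : StateSpace l p} (hf : f ∈ D.unobservable) :
    D.rowIntegral f (-l) l = 0 := by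
  funext α
  rw [← D.inner_channel]
  have h := congrArg (fun v : OuterSpace m => v (0, α)) (D.mem_unobservable.1 hf 0)
  simpa [PhiT_apply] using h

/-- The imaginary part of B factors through Φ̃, which kills f. -/
lemma adjoint_B_apply {f : StateSpace l p} (hf : f ∈ D.unobservable) :
    ContinuousLinearMap.adjoint D.B f = D.B f := by
  have h1 : D.PhiT f = 0 := by simpa using D.mem_unobservable.1 hf 0
  have h2 : D.imB f = 0 := by simp [imB_eq, h1]
  have h3 : D.B f - ContinuousLinearMap.adjoint D.B f = 0 := by
    simpa [imB, smul_eq_zero] using h2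
  exact (sub_eq_zero.1 h3).symm

/-- The operator `B - c`. -/
noncomputable def shiftB (c : ℝ) : StateSpace l p →L[ℂ] StateSpace l p := D.B - (c : ℂ) • 1

lemma shiftB_apply (c : ℝ) (f : StateSpace l p) : D.shiftB c f = D.B f - (c : ℂ) • f := rfl

lemma shiftB_mem_unobservable (c : ℝ) (f : StateSpace l p) (hf : f ∈ D.unobservable) :
    D.shiftB c f ∈ D.unobservable := by
  rw [shiftB_apply]
  exact D.unobservable.sub_mem (D.B_mem_unobservable hf) (D.unobservable.smul_mem _ hf)

lemma inner_B_left {f : StateSpace l p} (hf : f ∈ D.unobservable) (g : StateSpace l p) :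
    inner ℂ (D.B f) g = inner ℂ f (D.B g) := by
  rw [← D.adjoint_B_apply hf, ContinuousLinearMap.adjoint_inner_left]

lemma inner_shiftB_left (c : ℝ) (f : StateSpace l p) (hf : f ∈ D.unobservable)
    (g : StateSpace l p) (_ : g ∈ D.unobservable) :
    inner ℂ (D.shiftB c f) g = inner ℂ f (D.shiftB c g) := by
  rw [shiftB_apply, shiftB_apply, inner_sub_left, inner_sub_right, D.inner_B_left hf,
    inner_smul_left, inner_smul_right, Complex.conj_ofReal]

lemma norm_rowIntegral_le (f : StateSpace l p) {a c : ℝ} (ha : a ∈ Set.Icc (-l) l)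
    (hc : c ∈ Set.Icc (-l) l) (hac : a ≤ c) :
    ‖D.rowIntegral f a c‖ ≤ p * ∫ ξ in Set.Icc a c, ‖f ξ‖ := by
  have hsub : Set.Icc a c ⊆ Set.Icc (-l) l := Set.Icc_subset_Icc ha.1 hc.2
  rw [rowIntegral, intervalIntegral.integral_of_le hac, ← integral_Icc_eq_integral_Ioc,
    ← integral_const_mul]
  refine (norm_integral_le_integral_norm _).trans ?_
  exact setIntegral_mono_on (((D.integrableOn_row f).mono_set hsub).norm)
    (((integrable_norm f).norm.mono_measure (Measure.restrict_mono hsub le_rfl)).const_mul _)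
    measurableSet_Icc fun w hw => D.norm_vecMul_le (hsub hw) _

/-- On the unobservable subspace `B - c` is a multiplication up to a Volterra operator. -/
lemma exists_norm_shiftB_apply_le : ∃ K : ℝ, 0 ≤ K ∧ ∀ (c : ℝ) (f : StateSpace l p),
    f ∈ D.unobservable → ∀ᵐ w ∂volume.restrict (Set.Icc (-l) l),
      ‖D.shiftB c f w‖ ≤ |w - c| * ‖f w‖ + K * ‖D.rowIntegral f (-l) w‖ := by
  obtain ⟨C, hC, h⟩ := norm_vecMul_const_le (J₁ m r - J₂ m r)
  refine ⟨p * (m * C), by positivity, fun c f hf => ?_⟩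
  have hsub := Lp.coeFn_sub (D.B f) ((c : ℂ) • f)
  have hsm := Lp.coeFn_smul (c : ℂ) f
  filter_upwards [D.coeFn_B f, hsub, hsm, ae_restrict_mem measurableSet_Icc] with w h1 h2 h3 hw
  rw [shiftB_apply, h2, Pi.sub_apply, h1, h3, Pi.smul_apply, D.kernelFun_eq f hw,
    D.rowIntegral_eq_zero hf, Matrix.zero_vecMul, add_zero]
  have e : (w : ℂ) • f w + (WithLp.toLp 2 (Complex.I •
      ((D.rowIntegral f (-l) w ᵥ* (J₁ m r - J₂ m r)) ᵥ* (D.PiM w)ᴴ)) : EuclideanSpace ℂ (Fin p))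
      - (c : ℂ) • f w = ((w - c : ℝ) : ℂ) • f w + Complex.I • (WithLp.toLp 2
      ((D.rowIntegral f (-l) w ᵥ* (J₁ m r - J₂ m r)) ᵥ* (D.PiM w)ᴴ)) := by
    rw [WithLp.toLp_smul, Complex.ofReal_sub, sub_smul]
    abel
  rw [e]
  refine (norm_add_le _ _).trans ?_
  rw [norm_smul, norm_smul, Complex.norm_real, Complex.norm_I, one_mul, Real.norm_eq_abs]
  refine add_le_add le_rfl ((D.norm_toLp_conj_le hw _).trans ?_)
  calc (p : ℝ) * (m * ‖D.rowIntegral f (-l) w ᵥ* (J₁ m r - J₂ m r)‖)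
      ≤ p * (m * (C * ‖D.rowIntegral f (-l) w‖)) := by gcongr; exact h _
    _ = _ := by ring

/-- On a subinterval I containing its own domains of dependence s w, the Volterra term costs nothing
in the growth rate: the powers of B - c grow at most like those of any q above the supremum of |w -
c| on I. Keeping s and E abstract serves integration from either end. -/
lemma exists_integral_norm_pow_le {I : Set ℝ} (hI : MeasurableSet I) (hIl : I ⊆ Set.Icc (-l) l)
    {s : ℝ → Set ℝ} (hs : ∀ w ∈ I, s w ⊆ I)
    (hrow : ∀ f ∈ D.unobservable, ∀ w ∈ I,
      ‖D.rowIntegral f (-l) w‖ ≤ p * ∫ ξ in s w, ‖f ξ‖)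
    (hE : ∀ δ > (0 : ℝ), ∃ E : ℝ → ℝ, IntegrableOn E I ∧ ∀ w ∈ I, 1 ≤ E w ∧
      ∫ ξ in s w, E ξ ≤ δ * E w)
    {c R : ℝ} (hR : ∀ w ∈ I, |w - c| ≤ R) (hR₀ : 0 ≤ R) {q : ℝ} (hq : R < q)
    {f : StateSpace l p} (hf : f ∈ D.unobservable) :
    ∃ C, ∀ n : ℕ, ∫ ξ in I, ‖(D.shiftB c ^ n) f ξ‖ ≤ C * q ^ n := by
  obtain ⟨K, hK, hB⟩ := D.exists_norm_shiftB_apply_le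
  have hK' : 0 < 2 * (K * p + 1) := by positivity
  -- This δ makes R + 2(Kp + 1)δ equal to q; the added 1 keeps the denominator positive when Kp = 0.
  have hδ : 0 < (q - R) / (2 * (K * p + 1)) := div_pos (sub_pos.2 hq) hK'
  obtain ⟨E, hEi, hE⟩ := hE _ hδ
  have hrestr : ∀ w ∈ I, (volume.restrict I).restrict (s w) = volume.restrict (s w) := fun w hw =>
    Measure.restrict_restrict_of_subset (hs w hw)
  have hmem : ∀ᵐ w ∂volume.restrict I, w ∈ I := ae_restrict_mem hI
  have hle : volume.restrict I ≤ volume.restrict (Set.Icc (-l) l) :=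
    Measure.restrict_mono hIl le_rfl
  obtain ⟨C, hC⟩ := exists_integral_le_of_volterra (μ := volume.restrict I)
    (a := fun n w => ‖(D.shiftB c ^ n) f w‖) (s := s) (E := E) (R := R) (K := K * p + 1)
    (δ := (q - R) / (2 * (K * p + 1))) hR₀ (by positivity) hδ
    (fun n => (integrable_norm _).norm.mono_measure hle) (fun n w => norm_nonneg _) hEi
    (hmem.mono fun w hw => (hE w hw).1)
    (hmem.mono fun w hw => by rw [hrestr w hw]; exact (hE w hw).2)
    (fun n => by
      have hn := pow_apply_mem (D.shiftB_mem_unobservable c) hf n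
      filter_upwards [hmem, ae_mono hle (hB c _ hn)] with w hw h
      rw [hrestr w hw, pow_succ', mul_apply_eq_comp]
      have h0 : 0 ≤ ∫ ξ in s w, ‖(D.shiftB c ^ n) f ξ‖ := integral_nonneg fun _ => norm_nonneg _
      have h1 := hrow _ hn w hw
      have h2 := hR w hw
      calc _ ≤ |w - c| * ‖(D.shiftB c ^ n) f w‖
            + K * ‖D.rowIntegral ((D.shiftB c ^ n) f) (-l) w‖ := h
        _ ≤ R * ‖(D.shiftB c ^ n) f w‖
            + K * (p * ∫ ξ in s w, ‖(D.shiftB c ^ n) f ξ‖) := by gcongr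
        _ ≤ _ := by linarith)
  refine ⟨C, fun n => (hC n).trans_eq ?_⟩
  congr 2
  field_simp
  ring

lemma exists_norm_rowIntegral_pow_le_left {w₀ : ℝ} (hw₀ : w₀ ∈ Set.Icc (-l) l) {c R : ℝ}
    (hR : ∀ w ∈ Set.Icc (-l) w₀, |w - c| ≤ R) (hR₀ : 0 ≤ R) {q : ℝ} (hq : R < q)
    {f : StateSpace l p} (hf : f ∈ D.unobservable) :
    ∃ C, ∀ n : ℕ, ‖D.rowIntegral ((D.shiftB c ^ n) f) (-l) w₀‖ ≤ C * q ^ n := by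
  have hsub : Set.Icc (-l) w₀ ⊆ Set.Icc (-l) l := Set.Icc_subset_Icc_right hw₀.2
  obtain ⟨C, hC⟩ := D.exists_integral_norm_pow_le (s := fun w => Set.Icc (-l) w)
    measurableSet_Icc hsub (fun w hw => Set.Icc_subset_Icc_right hw.2)
    (fun f _ w hw => D.norm_rowIntegral_le f D.neg_l_mem (hsub hw) hw.1)
    (fun δ hδ => by
      -- The integral of this weight over [-l, w] is δ(E(w) - 1).
      refine ⟨fun w => Real.exp ((w + l) / δ), ?_, fun w hw => ⟨?_, ?_⟩⟩
      · exact Continuous.integrableOn_Icc (by fun_prop)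
      · rw [Real.one_le_exp_iff]
        exact div_nonneg (by linarith [hw.1]) hδ.le
      · rw [integral_Icc_eq_integral_Ioc, ← intervalIntegral.integral_of_le hw.1,
          intervalIntegral.integral_eq_sub_of_hasDerivAt
            (f := fun x => δ * Real.exp ((x + l) / δ)) (fun x _ => ?_)
            (Continuous.intervalIntegrable (by fun_prop) _ _)]
        · have : 0 < δ * Real.exp ((-l + l) / δ) := by positivity
          linarith
        · have := ((((hasDerivAt_id x).add_const l).div_const δ).exp).const_mul δ
          refine this.congr_deriv ?_
          simp only [id]
          field_simp)
    hR hR₀ hq hf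
  refine ⟨p * C, fun n => ?_⟩
  refine (D.norm_rowIntegral_le _ D.neg_l_mem hw₀ hw₀.1).trans ?_
  rw [mul_assoc]
  exact mul_le_mul_of_nonneg_left (hC n) (by positivity)

/-- On the unobservable subspace the total integral of fΠ vanishes, so the primitive can equally be
computed from the right end. -/
lemma norm_rowIntegral_le_right {f : StateSpace l p} (hf : f ∈ D.unobservable) {w : ℝ}
    (hw : w ∈ Set.Icc (-l) l) :
    ‖D.rowIntegral f (-l) w‖ ≤ p * ∫ ξ in Set.Icc w l, ‖f ξ‖ := by
  have h := D.rowIntegral_add_adjacent f hw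
  rw [D.rowIntegral_eq_zero hf] at h
  rw [eq_neg_of_add_eq_zero_left h, norm_neg]
  exact D.norm_rowIntegral_le f hw D.l_mem hw.2

lemma exists_norm_rowIntegral_pow_le_right {w₀ : ℝ} (hw₀ : w₀ ∈ Set.Icc (-l) l) {c R : ℝ}
    (hR : ∀ w ∈ Set.Icc w₀ l, |w - c| ≤ R) (hR₀ : 0 ≤ R) {q : ℝ} (hq : R < q)
    {f : StateSpace l p} (hf : f ∈ D.unobservable) :
    ∃ C, ∀ n : ℕ, ‖D.rowIntegral ((D.shiftB c ^ n) f) (-l) w₀‖ ≤ C * q ^ n := by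
  have hsub : Set.Icc w₀ l ⊆ Set.Icc (-l) l := Set.Icc_subset_Icc_left hw₀.1
  obtain ⟨C, hC⟩ := D.exists_integral_norm_pow_le (s := fun w => Set.Icc w l)
    measurableSet_Icc hsub (fun w hw => Set.Icc_subset_Icc_left hw.1)
    (fun f hf w hw => D.norm_rowIntegral_le_right hf (hsub hw))
    (fun δ hδ => by
      refine ⟨fun w => Real.exp ((l - w) / δ), ?_, fun w hw => ⟨?_, ?_⟩⟩
      · exact Continuous.integrableOn_Icc (by fun_prop)
      · rw [Real.one_le_exp_iff]
        exact div_nonneg (by linarith [hw.2]) hδ.le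
      · rw [integral_Icc_eq_integral_Ioc, ← intervalIntegral.integral_of_le hw.2,
          intervalIntegral.integral_eq_sub_of_hasDerivAt
            (f := fun x => -δ * Real.exp ((l - x) / δ)) (fun x _ => ?_)
            (Continuous.intervalIntegrable (by fun_prop) _ _)]
        · have : 0 < δ * Real.exp ((l - l) / δ) := by positivity
          linarith
        · have := ((((hasDerivAt_id x).const_sub l).div_const δ).exp).const_mul (-δ)
          refine this.congr_deriv ?_
          simp only [id]
          field_simp)
    hR hR₀ hq hf
  refine ⟨p * C, fun n => ?_⟩
  refine (D.norm_rowIntegral_le_right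
    (pow_apply_mem (D.shiftB_mem_unobservable c) hf n) hw₀).trans ?_
  rw [mul_assoc]
  exact mul_le_mul_of_nonneg_left (hC n) (by positivity)

/-- A vector of the unobservable subspace representing `f ↦ ∫_{-l}^w f Π_α` is an eigenvector. -/
lemma B_apply_of_represents {w₀ : ℝ} (hw₀ : w₀ ∈ Set.Icc (-l) l) (α : Fin m)
    {k : StateSpace l p} (hk : k ∈ D.unobservable)
    (hkf : ∀ f ∈ D.unobservable, inner ℂ k f = D.rowIntegral f (-l) w₀ α) :
    D.B k = (w₀ : ℂ) • k := by
  have hl := D.l_pos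
  have key : ∀ c : ℝ, (∀ q : ℝ, 2 * l < q → ∃ C, ∀ n : ℕ,
      ‖D.rowIntegral ((D.shiftB c ^ n) k) (-l) w₀‖ ≤ C * q ^ n) →
      ‖D.shiftB c k‖ ≤ 2 * l * ‖k‖ := by
    intro c hc
    have hq : ∀ q : ℝ, 2 * l < q → ‖D.shiftB c k‖ ≤ q * ‖k‖ := by
      intro q hq
      obtain ⟨C, hC⟩ := hc q hq
      refine norm_apply_le_of_norm_inner_pow_le (D.shiftB_mem_unobservable c)
        (D.inner_shiftB_left c) hk (by linarith) (C := C) fun n => ?_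
      rw [hkf _ (pow_apply_mem (D.shiftB_mem_unobservable c) hk n)]
      exact (norm_le_pi_norm _ α).trans (hC n)
    have hlim : Tendsto (fun q : ℝ => q * ‖k‖) (𝓝[>] (2 * l)) (𝓝 (2 * l * ‖k‖)) :=
      ((continuous_id.mul continuous_const).tendsto _).mono_left nhdsWithin_le_nhds
    exact ge_of_tendsto hlim (eventually_nhdsWithin_of_forall hq)
  -- The centres w₀ ∓ 2l put [-l, w₀] and [w₀, l] respectively within distance 2l. With x = (B -
  -- w₀)k and y = 2lk this yields ‖x ± y‖ ≤ ‖y‖, and the parallelogram law forces x = 0.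
  have h1 := key (w₀ - 2 * l) fun q hq =>
    D.exists_norm_rowIntegral_pow_le_left hw₀ (fun w hw => abs_le.2
      ⟨by linarith [hw.1, hw₀.2], by linarith [hw.2]⟩) (by linarith) hq hk
  have h2 := key (w₀ + 2 * l) fun q hq =>
    D.exists_norm_rowIntegral_pow_le_right hw₀ (fun w hw => abs_le.2
      ⟨by linarith [hw.1], by linarith [hw.2, hw₀.1]⟩) (by linarith) hq hk
  set x := D.B k - (w₀ : ℂ) • k with hx
  set y := ((2 * l : ℝ) : ℂ) • k with hy
  have e1 : D.shiftB (w₀ - 2 * l) k = x + y := by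
    rw [shiftB_apply, Complex.ofReal_sub, sub_smul, hx, hy]; abel
  have e2 : D.shiftB (w₀ + 2 * l) k = x - y := by
    rw [shiftB_apply, Complex.ofReal_add, add_smul, hx, hy]; abel
  have hyn : ‖y‖ = 2 * l * ‖k‖ := by
    rw [hy, norm_smul, Complex.norm_real, Real.norm_of_nonneg (by linarith)]
  rw [e1, ← hyn] at h1
  rw [e2, ← hyn] at h2
  have hpar := parallelogram_law_with_norm ℂ x y
  have hx0 : ‖x‖ = 0 := by
    nlinarith [norm_nonneg x, norm_nonneg (x + y), norm_nonneg (x - y), norm_nonneg y]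
  exact sub_eq_zero.1 (norm_eq_zero.1 hx0)

/-- The functional `f ↦ (∫_{-l}^w f Π)_α`. -/
noncomputable def rowFunctional {w : ℝ} (hw : w ∈ Set.Icc (-l) l) (α : Fin m) : StateSpace l p →L[ℂ] ℂ :=
  LinearMap.mkContinuousOfExistsBound
    { toFun := fun f => D.rowIntegral f (-l) w α
      map_add' := fun f g => by rw [D.rowIntegral_add f g D.neg_l_mem hw]; rfl
      map_smul' := fun k f => by rw [D.rowIntegral_smul k f D.neg_l_mem hw]; rfl }
    (by
      obtain ⟨C, _, h⟩ := D.exists_rowIntegral_le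
      exact ⟨C, fun f => (norm_le_pi_norm _ α).trans (h f _ D.neg_l_mem _ hw)⟩)

lemma exists_represents {w : ℝ} (hw : w ∈ Set.Icc (-l) l) (α : Fin m) :
    ∃ k ∈ D.unobservable, ∀ f ∈ D.unobservable, inner ℂ k f = D.rowIntegral f (-l) w α := by
  have : CompleteSpace D.unobservable := D.isClosed_unobservable.completeSpace_coe
  let ℓ := D.rowFunctional hw α ∘L D.unobservable.subtypeL
  refine ⟨(InnerProductSpace.toDual ℂ D.unobservable).symm ℓ, Subtype.property _, fun f hf => ?_⟩
  exact InnerProductSpace.toDual_symm_apply (𝕜 := ℂ) (E := D.unobservable) (x := ⟨f, hf⟩) (y := ℓ)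

/-- The representing vectors k_w are pairwise orthogonal eigenvectors, so the primitive of k_w Π has
zero α-component at every w' ≠ w. By continuity it is zero at w too, where its value is ‖k_w‖². -/
lemma rowIntegral_eq_zero_of_mem {f : StateSpace l p} (hf : f ∈ D.unobservable) {w : ℝ}
    (hw : w ∈ Set.Icc (-l) l) : D.rowIntegral f (-l) w = 0 := by
  funext α
  choose k hk hkf using fun w : Set.Icc (-l) l => D.exists_represents w.2 α
  have heig : ∀ w, D.B (k w) = ((w : ℝ) : ℂ) • k w := fun w =>
    D.B_apply_of_represents w.2 α (hk w) (hkf w)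
  have horth : ∀ w w', w ≠ w' → inner ℂ (k w) (k w') = 0 := by
    intro w w' hne
    have h := D.inner_B_left (hk w) (k w')
    rw [heig, heig, inner_smul_left, inner_smul_right, Complex.conj_ofReal] at h
    have h2 : (((w : ℝ) : ℂ) - ((w' : ℝ) : ℂ)) * inner ℂ (k w) (k w') = 0 := by
      rw [sub_mul, h, sub_self]
    refine (mul_eq_zero.1 h2).resolve_left ?_
    exact fun hc => hne (Subtype.ext (Complex.ofReal_injective (sub_eq_zero.1 hc)))
  have hzero : k ⟨w, hw⟩ = 0 := by
    set k₀ := k ⟨w, hw⟩ with hk₀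
    have hcont : Tendsto (fun w' => D.rowIntegral k₀ (-l) w' α) (𝓝[≠] w ⊓ 𝓟 (Set.Icc (-l) l))
        (𝓝 (D.rowIntegral k₀ (-l) w α)) := by
      have h := ((continuous_apply α).comp_continuousOn (D.continuousOn_rowIntegral_left k₀)) w hw
      exact Tendsto.mono_left h (inf_le_inf_right _ nhdsWithin_le_nhds)
    have hev : (fun w' => D.rowIntegral k₀ (-l) w' α) =ᶠ[𝓝[≠] w ⊓ 𝓟 (Set.Icc (-l) l)]
        fun _ => 0 := by
      have h1 : ∀ᶠ w' in 𝓝[≠] w ⊓ 𝓟 (Set.Icc (-l) l), w' ≠ w :=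
        (eventually_mem_nhdsWithin : ∀ᶠ w' in 𝓝[≠] w, w' ∈ ({w}ᶜ : Set ℝ)).filter_mono inf_le_left
      have h2 : ∀ᶠ w' in 𝓝[≠] w ⊓ 𝓟 (Set.Icc (-l) l), w' ∈ Set.Icc (-l) l :=
        (eventually_principal.2 fun _ h => h).filter_mono inf_le_right
      filter_upwards [h1, h2] with w' hne hm
      rw [← hkf ⟨w', hm⟩ k₀ (hk _)]
      exact horth _ _ fun hc => hne (congrArg Subtype.val hc)
    -- The limit is taken within the interval, so that the endpoints w = ±l are covered.
    have hacc : (𝓝[≠] w ⊓ 𝓟 (Set.Icc (-l) l)).NeBot :=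
      (uniqueDiffOn_Icc (by linarith [D.l_pos]) w hw).accPt
    have hval : D.rowIntegral k₀ (-l) w α = 0 :=
      tendsto_nhds_unique hcont ((tendsto_const_nhds).congr' hev.symm)
    rw [← hkf ⟨w, hw⟩ k₀ (hk _)] at hval
    exact inner_self_eq_zero.1 hval
  rw [← hkf ⟨w, hw⟩ f hf, hzero, inner_zero_left]
  rfl

/-- The triangular model is completely non-selfadjoint. -/
lemma unobservable_eq_bot : D.unobservable = ⊥ := by
  rw [eq_bot_iff]
  intro f hf
  rw [Submodule.mem_bot]
  have hl : -l ≤ l := D.l_mem.1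
  have hint : IntervalIntegrable (fun ξ => (f ξ).ofLp ᵥ* D.PiM ξ) volume (-l) l :=
    D.intervalIntegrable_row f D.neg_l_mem D.l_mem
  have hrow : ∀ᵐ w ∂volume.restrict (Set.Icc (-l) l), (f w).ofLp ᵥ* D.PiM w = 0 := by
    refine ae_mono (restrict_Ioo_eq_restrict_Icc).ge ((ae_restrict_iff' measurableSet_Ioo).2 ?_)
    filter_upwards [hint.ae_hasDerivAt_integral] with w h hw
    have hw' : w ∈ Set.Icc (-l) l := Set.Ioo_subset_Icc_self hw
    have hd := h (by rwa [Set.uIcc_of_le hl]) (-l) (by rw [Set.uIcc_of_le hl]; exact D.neg_l_mem)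
    have hev : (fun x => ∫ ξ in (-l)..x, (f ξ).ofLp ᵥ* D.PiM ξ) =ᶠ[𝓝 w] fun _ => 0 := by
      filter_upwards [Icc_mem_nhds hw.1 hw.2] with x hx
      exact D.rowIntegral_eq_zero_of_mem hf hx
    exact hd.unique ((hasDerivAt_const w (0 : Fin m → ℂ)).congr_of_eventuallyEq hev)
  refine (Lp.eq_zero_iff_ae_eq_zero).2 ?_
  filter_upwards [hrow, ae_restrict_mem measurableSet_Icc] with w h hw
  obtain ⟨Q, hQ⟩ := D.right_inv w hw
  have h2 : ((f w).ofLp ᵥ* D.PiM w) ᵥ* Q = 0 := by rw [h, Matrix.zero_vecMul]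
  rw [Matrix.vecMul_vecMul, hQ, Matrix.vecMul_one] at h2
  exact (WithLp.ofLp_injective 2) h2

end TriangularData

/-- The integrals over [R, R + 1] tend to c because y does, and to 0 by the Cauchy property of the
improper integral. -/
lemma tendsto_eq_zero_of_integral_tendsto {F : Type*} [NormedAddCommGroup F] [NormedSpace ℝ F]
    [CompleteSpace F] {y : ℝ → F} (hy : Continuous y) {c J : F} (hc : Tendsto y atTop (𝓝 c))
    (hJ : Tendsto (fun R : ℝ => ∫ η in (0 : ℝ)..R, y η) atTop (𝓝 J)) : c = 0 := by
  have h1 : Tendsto (fun R : ℝ => ∫ η in R..(R + 1), y η) atTop (𝓝 0) := by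
    have h := (hJ.comp (tendsto_atTop_add_const_right atTop (1 : ℝ) tendsto_id)).sub hJ
    rw [sub_self] at h
    refine h.congr fun R => ?_
    exact intervalIntegral.integral_interval_sub_left (hy.intervalIntegrable _ _)
      (hy.intervalIntegrable _ _)
  have h2 : Tendsto (fun R : ℝ => ∫ η in R..(R + 1), y η) atTop (𝓝 c) := by
    rw [Metric.tendsto_atTop] at hc ⊢
    intro ε hε
    obtain ⟨R₀, hR₀⟩ := hc (ε / 2) (by positivity)
    refine ⟨R₀, fun R hR => ?_⟩
    have e : (∫ η in R..(R + 1), y η) - c = ∫ η in R..(R + 1), (y η - c) := by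
      rw [intervalIntegral.integral_sub (hy.intervalIntegrable _ _) (by simp)]
      simp
    rw [dist_eq_norm, e]
    have := intervalIntegral.norm_integral_le_of_norm_le_const (a := R) (b := R + 1)
      (f := fun η => y η - c) (C := ε / 2) (fun η hη => by
        rw [Set.uIoc_of_le (by linarith)] at hη
        have := hR₀ η (hR.le.trans hη.1.le)
        rw [dist_eq_norm] at this
        exact this.le)
    simp only [add_sub_cancel_left, abs_one, mul_one] at this
    linarith
  exact tendsto_nhds_unique h2 h1

lemma real_smul_eq_ofReal_smul {𝔸 : Type*} [NormedRing 𝔸] [NormedAlgebra ℂ 𝔸] (a : ℝ) (X : 𝔸) :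
    a • X = (a : ℂ) • X := rfl

section Evaluation

variable {H G : Type*} [NormedAddCommGroup H] [NormedSpace ℂ H] [NormedAddCommGroup G]
  [NormedSpace ℂ G]

lemma hasDerivAt_apply_const {c : ℝ → H →L[ℂ] G} {c' : H →L[ℂ] G} {x : ℝ}
    (hc : HasDerivAt c c' x) (v : H) : HasDerivAt (fun y => c y v) (c' v) x :=
  (((ContinuousLinearMap.apply ℂ G v).restrictScalars ℝ).hasFDerivAt).comp_hasDerivAt x hc

lemma hasDerivAt_map {f : ℝ → H} {f' : H} {x : ℝ} (Λ : H →L[ℂ] G) (hf : HasDerivAt f f' x) :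
    HasDerivAt (fun y => Λ (f y)) (Λ f') x :=
  ((Λ.restrictScalars ℝ).hasFDerivAt).comp_hasDerivAt x hf

end Evaluation

/-! ### Conjugation by U and the Sylvester equation. -/

namespace TriangularData

variable {l : ℝ} {p m r : ℕ} (D : TriangularData l p m r)

/-- The operator `iB`. -/
noncomputable def iB : StateSpace l p →L[ℂ] StateSpace l p := Complex.I • D.B

/-- Since (iB)³ = -iB³, the exponent ibB³ equals -b(iB)³. -/
lemma T_eq_phase (b x t : ℝ) : D.T b x t = phase b D.iB x t := by
  unfold T phase A iB
  congr 1
  rw [smul_pow]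
  simp only [real_smul_eq_ofReal_smul, smul_smul, smul_add]
  rw [add_comm]
  congr 2
  · ring
  · push_cast
    rw [show Complex.I ^ 3 = -Complex.I from Complex.I_pow_three]
    ring

lemma expB_eq_phase (b ξ : ℝ) : D.expB ξ = phase b D.iB ξ 0 := by
  unfold phase expB iB
  simp only [real_smul_eq_ofReal_smul, Complex.ofReal_zero, zero_smul, add_zero, smul_smul,
    mul_comm, mul_zero]

lemma hasDerivAt_expB_apply (ξ : ℝ) (v : StateSpace l p) :
    HasDerivAt (fun y => D.expB y v) (D.iB (D.expB ξ v)) ξ := by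
  simp only [D.expB_eq_phase 0]
  exact hasDerivAt_apply_const (hasDerivAt_phase_fst 0 D.iB ξ 0) v

lemma iB_expB (ξ : ℝ) (v : StateSpace l p) : D.iB (D.expB ξ v) = D.expB ξ (D.iB v) := by
  rw [D.expB_eq_phase 0]
  exact congrArg (fun X : StateSpace l p →L[ℂ] StateSpace l p => X v)
    (commute_phase 0 D.iB ξ 0).eq

lemma expB_zero : D.expB 0 = 1 := by
  rw [D.expB_eq_phase 0, phase_zero]

section Conjugation

variable {D} {U : StateSpace l p →L[ℂ] StateSpace l p}

lemma exp_conj_unitary (hU₁ : ContinuousLinearMap.adjoint U * U = 1)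
    (hU₂ : U * ContinuousLinearMap.adjoint U = 1) (X : StateSpace l p →L[ℂ] StateSpace l p) :
    ContinuousLinearMap.adjoint U * NormedSpace.exp (U * X * ContinuousLinearMap.adjoint U)
      = NormedSpace.exp X * ContinuousLinearMap.adjoint U := by
  let _ : NormedAlgebra ℚ (StateSpace l p →L[ℂ] StateSpace l p) :=
    NormedAlgebra.restrictScalars ℚ ℂ _
  have h := NormedSpace.exp_units_conj
    (⟨U, ContinuousLinearMap.adjoint U, hU₂, hU₁⟩ : (StateSpace l p →L[ℂ] StateSpace l p)ˣ) X
  simp only [Units.inv_mk] at h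
  rw [h, ← mul_assoc, ← mul_assoc, hU₁, one_mul]

lemma adjoint_B_pow_three (hU₁ : ContinuousLinearMap.adjoint U * U = 1)
    (hBU : ContinuousLinearMap.adjoint D.B = -(U * D.B * ContinuousLinearMap.adjoint U)) :
    ContinuousLinearMap.adjoint (D.B ^ 3) = -(U * D.B ^ 3 * ContinuousLinearMap.adjoint U) := by
  have e : ContinuousLinearMap.adjoint (D.B ^ 3) = (ContinuousLinearMap.adjoint D.B) ^ 3 :=
    star_pow D.B 3
  have hc : ∀ X Y : StateSpace l p →L[ℂ] StateSpace l p,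
      (U * X * ContinuousLinearMap.adjoint U) * (U * Y * ContinuousLinearMap.adjoint U)
        = U * (X * Y) * ContinuousLinearMap.adjoint U := by
    intro X Y
    calc _ = U * X * (ContinuousLinearMap.adjoint U * U) * Y * ContinuousLinearMap.adjoint U := by
          noncomm_ring
      _ = _ := by rw [hU₁]; noncomm_ring
  rw [e, hBU, Odd.neg_pow (by decide), pow_three, hc, hc, ← pow_three]

/-- Both B and the odd power B³ change sign when their adjoints are carried through U, so the
adjoint motion becomes the reversed motion T(-x,-t). -/
lemma adjoint_mul_TStarInv (hU₁ : ContinuousLinearMap.adjoint U * U = 1)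
    (hU₂ : U * ContinuousLinearMap.adjoint U = 1)
    (hBU : ContinuousLinearMap.adjoint D.B = -(U * D.B * ContinuousLinearMap.adjoint U))
    (b x t : ℝ) :
    ContinuousLinearMap.adjoint U * D.TStarInv b x t
      = D.T b (-x) (-t) * ContinuousLinearMap.adjoint U := by
  have hA : ContinuousLinearMap.adjoint (D.A b)
      = -(U * D.A b * ContinuousLinearMap.adjoint U) := by
    unfold A
    rw [map_smulₛₗ, Complex.conj_ofReal, adjoint_B_pow_three hU₁ hBU, mul_smul_comm,
      smul_mul_assoc, smul_neg]
  unfold TStarInv T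
  rw [← exp_conj_unitary hU₁ hU₂, hA, hBU]
  congr 2
  simp only [mul_smul_comm, smul_mul_assoc, mul_add, add_mul, Complex.ofReal_neg, neg_smul,
    smul_neg, mul_neg, neg_mul]

lemma adjoint_mul_expNegBStar (hU₁ : ContinuousLinearMap.adjoint U * U = 1)
    (hU₂ : U * ContinuousLinearMap.adjoint U = 1)
    (hBU : ContinuousLinearMap.adjoint D.B = -(U * D.B * ContinuousLinearMap.adjoint U))
    (η : ℝ) :
    ContinuousLinearMap.adjoint U * D.expNegBStar η
      = D.expB η * ContinuousLinearMap.adjoint U := by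
  unfold expNegBStar expB
  rw [← exp_conj_unitary hU₁ hU₂, hBU]
  congr 2
  simp only [mul_smul_comm, smul_mul_assoc, neg_smul, smul_neg, neg_neg]

lemma Gam_eq_twoWave (hU₁ : ContinuousLinearMap.adjoint U * U = 1)
    (hU₂ : U * ContinuousLinearMap.adjoint U = 1)
    (hBU : ContinuousLinearMap.adjoint D.B = -(U * D.B * ContinuousLinearMap.adjoint U))
    (M : StateSpace l p →L[ℂ] StateSpace l p) (b x t : ℝ) :
    D.Gam b U M x t = twoWave b D.iB (ContinuousLinearMap.adjoint U * M) x t := by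
  rw [Gam, adjoint_mul_TStarInv hU₁ hU₂ hBU, T_eq_phase, T_eq_phase, twoWave, mul_assoc]

lemma soliton_eq_logDerivWave (hU₁ : ContinuousLinearMap.adjoint U * U = 1)
    (hU₂ : U * ContinuousLinearMap.adjoint U = 1)
    (hBU : ContinuousLinearMap.adjoint D.B = -(U * D.B * ContinuousLinearMap.adjoint U))
    (M : StateSpace l p →L[ℂ] StateSpace l p) (b x t : ℝ) :
    D.soliton b U M x t = logDerivWave b D.iB (ContinuousLinearMap.adjoint U * M) x t := by
  simp only [soliton, Gam_eq_twoWave hU₁ hU₂ hBU, logDerivWave]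
  congr 1
  exact (hasDerivAt_twoWave_fst b D.iB (ContinuousLinearMap.adjoint U * M) x t).deriv

end Conjugation

lemma continuous_expB_apply (v : StateSpace l p) : Continuous fun ξ => D.expB ξ v :=
  continuous_iff_continuousAt.2 fun ξ => (D.hasDerivAt_expB_apply ξ v).continuousAt

lemma hasDerivAt_expB (ξ : ℝ) : HasDerivAt D.expB (D.iB * D.expB ξ) ξ := by
  have h := hasDerivAt_phase_fst 0 D.iB ξ 0
  simp only [← D.expB_eq_phase 0] at h
  exact h

lemma hasDerivAt_sandwich (K : StateSpace l p →L[ℂ] StateSpace l p) (f : StateSpace l p) (η : ℝ) :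
    HasDerivAt (fun y => D.expB y (K (D.expB y f)))
      (D.iB (D.expB η (K (D.expB η f))) + D.expB η (K (D.expB η (D.iB f)))) η := by
  have h := hasDerivAt_apply_const
    (((D.hasDerivAt_expB η).mul_const K).mul (D.hasDerivAt_expB η)) f
  refine h.congr_deriv ?_
  rw [← D.iB_expB]
  rfl

lemma continuous_sandwich (K : StateSpace l p →L[ℂ] StateSpace l p) (f : StateSpace l p) :
    Continuous fun y => D.expB y (K (D.expB y f)) :=
  continuous_iff_continuousAt.2 fun η => (D.hasDerivAt_sandwich K f η).continuousAt

lemma integral_map_comm {G : Type*} [NormedAddCommGroup G] [NormedSpace ℂ G] [CompleteSpace G]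
    (Λ : StateSpace l p →L[ℂ] G) {y : ℝ → StateSpace l p} (hy : Continuous y) (R : ℝ) :
    ∫ η in (0 : ℝ)..R, Λ (y η) = Λ (∫ η in (0 : ℝ)..R, y η) :=
  (Λ.restrictScalars ℝ).intervalIntegral_comp_comm (hy.intervalIntegrable _ _)

lemma integral_op_comm (Λ : StateSpace l p →L[ℂ] StateSpace l p) {y : ℝ → StateSpace l p}
    (hy : Continuous y) (R : ℝ) :
    ∫ η in (0 : ℝ)..R, Λ (y η) = Λ (∫ η in (0 : ℝ)..R, y η) :=
  integral_map_comm Λ hy R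

/-- The Sylvester equation for a convergent integral `∫_0^∞ exp(iηB) K exp(iηB) dη`. -/
lemma sylvester {K M₀ : StateSpace l p →L[ℂ] StateSpace l p}
    (hM : ∀ f, Tendsto (fun R : ℝ => ∫ η in (0 : ℝ)..R, D.expB η (K (D.expB η f))) atTop
      (𝓝 (M₀ f))) : D.iB * M₀ + M₀ * D.iB = -K := by
  refine ContinuousLinearMap.ext fun f => ?_
  have hc := D.continuous_sandwich K
  have h1 : Tendsto (fun R : ℝ => ∫ η in (0 : ℝ)..R,
      (D.iB (D.expB η (K (D.expB η f))) + D.expB η (K (D.expB η (D.iB f))))) atTop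
      (𝓝 (D.iB (M₀ f) + M₀ (D.iB f))) := by
    refine (((D.iB.continuous.tendsto _).comp (hM f)).add (hM (D.iB f))).congr fun R => ?_
    have hi : IntervalIntegrable (fun η => D.iB (D.expB η (K (D.expB η f)))) volume 0 R :=
      (D.iB.continuous.comp (hc f)).intervalIntegrable _ _
    rw [intervalIntegral.integral_add hi ((hc _).intervalIntegrable _ _),
      integral_op_comm D.iB (hc f) R]
    rfl
  have h2 : ∀ R : ℝ, ∫ η in (0 : ℝ)..R,
      (D.iB (D.expB η (K (D.expB η f))) + D.expB η (K (D.expB η (D.iB f))))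
      = D.expB R (K (D.expB R f)) - K f := by
    intro R
    rw [intervalIntegral.integral_eq_sub_of_hasDerivAt (fun η _ => D.hasDerivAt_sandwich K f η)
      (((D.iB.continuous.comp (hc f)).add (hc _)).intervalIntegrable _ _)]
    simp [expB_zero]
  simp only [h2] at h1
  -- Convergence of the integrated derivative shows only that the integrand has a limit; convergence
  -- of the integral itself then makes that limit zero.
  have h3 := h1.add_const (K f)
  simp only [sub_add_cancel] at h3
  have h4 := tendsto_eq_zero_of_integral_tendsto (hc f) h3 (hM f)
  exact eq_neg_of_add_eq_zero_left h4

lemma adjoint_mul_tendsto {U ρ M : StateSpace l p →L[ℂ] StateSpace l p}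
    (hU₁ : ContinuousLinearMap.adjoint U * U = 1) (hU₂ : U * ContinuousLinearMap.adjoint U = 1)
    (hBU : ContinuousLinearMap.adjoint D.B = -(U * D.B * ContinuousLinearMap.adjoint U))
    (hM : D.IsStrongIntegral ρ M) (f : StateSpace l p) :
    Tendsto (fun R : ℝ => ∫ η in (0 : ℝ)..R,
      D.expB η ((ContinuousLinearMap.adjoint U * ρ * D.imB) (D.expB η f))) atTop
      (𝓝 ((ContinuousLinearMap.adjoint U * M) f)) := by
  have he : ∀ η, D.expB η ((ContinuousLinearMap.adjoint U * ρ * D.imB) (D.expB η f))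
      = ContinuousLinearMap.adjoint U (D.expNegBStar η (ρ (D.imB (D.expB η f)))) := fun η =>
    congrArg (fun X : StateSpace l p →L[ℂ] StateSpace l p => X (ρ (D.imB (D.expB η f))))
      (adjoint_mul_expNegBStar hU₁ hU₂ hBU η).symm
  have hcont : Continuous fun η => D.expNegBStar η (ρ (D.imB (D.expB η f))) := by
    have h : (fun η => D.expNegBStar η (ρ (D.imB (D.expB η f))))
        = fun η => U (D.expB η ((ContinuousLinearMap.adjoint U * ρ * D.imB) (D.expB η f))) := by
      funext η
      rw [he]
      exact (congrArg (fun X : StateSpace l p →L[ℂ] StateSpace l p =>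
        X (D.expNegBStar η (ρ (D.imB (D.expB η f))))) hU₂).symm
    rw [h]
    exact U.continuous.comp (D.continuous_sandwich _ f)
  simp only [he, integral_op_comm _ hcont]
  exact ((ContinuousLinearMap.adjoint U).continuous.tendsto _).comp (hM f)

/-! ### Modes: injectivity and energy balance. -/

section Modes

lemma hasDerivAt_mode (h : StateSpace l p) (ξ : ℝ) :
    HasDerivAt (D.mode h) (D.mode (D.iB h) ξ) ξ := by
  have := hasDerivAt_map D.PhiT (D.hasDerivAt_expB_apply ξ h)
  rw [D.iB_expB] at this
  exact this

lemma iB_pow_apply (n : ℕ) (k : StateSpace l p) :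
    (D.iB ^ n) k = Complex.I ^ n • (D.B ^ n) k := by
  rw [iB, smul_pow]
  rfl

/-- The right derivatives of the mode at 0 are iⁿΦ̃Bⁿk, so k is unobservable. Only the half-line is
assumed because the integral equation holds only there. -/
lemma eq_zero_of_mode_eq_zero {k : StateSpace l p} (hk : ∀ ξ : ℝ, 0 ≤ ξ → D.mode k ξ = 0) :
    k = 0 := by
  have hn : ∀ n : ℕ, ∀ ξ : ℝ, 0 ≤ ξ → D.mode ((D.iB ^ n) k) ξ = 0 := by
    intro n
    induction n with
    | zero => simpa using hk
    | succ n ih =>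
      intro ξ hξ
      have h1 := (D.hasDerivAt_mode ((D.iB ^ n) k) ξ).hasDerivWithinAt (s := Set.Ici ξ)
      have h2 : HasDerivWithinAt (D.mode ((D.iB ^ n) k)) 0 (Set.Ici ξ) ξ :=
        (hasDerivWithinAt_const ξ (Set.Ici ξ) (0 : OuterSpace m)).congr
          (fun y hy => ih y (hξ.trans hy)) (ih ξ hξ)
      rw [pow_succ']
      exact (uniqueDiffOn_Ici ξ ξ Set.self_mem_Ici).eq_deriv _ h1 h2
  have hmem : k ∈ D.unobservable := by
    rw [mem_unobservable]
    intro n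
    have h := hn n 0 le_rfl
    rw [mode, expB_zero, iB_pow_apply] at h
    have h' : Complex.I ^ n • D.PhiT ((D.B ^ n) k) = 0 := by
      rw [← map_smul]; exact h
    exact (smul_eq_zero.1 h').resolve_left (pow_ne_zero n Complex.I_ne_zero)
  rw [unobservable_eq_bot] at hmem
  exact (Submodule.mem_bot ℂ).1 hmem

lemma mode_sub (h k : StateSpace l p) (ξ : ℝ) : D.mode (h - k) ξ = D.mode h ξ - D.mode k ξ := by
  simp [mode]

lemma mode_injective : Function.Injective D.mode := by
  intro h k hhk
  refine sub_eq_zero.1 (D.eq_zero_of_mode_eq_zero fun ξ _ => ?_)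
  rw [mode_sub, hhk, sub_self]

lemma inner_imB (f h : StateSpace l p) :
    inner ℂ f (D.imB h) = inner ℂ (D.PhiT f) (D.sigmaB (D.PhiT h)) := by
  rw [imB_eq, ContinuousLinearMap.comp_apply, ContinuousLinearMap.adjoint_inner_right]
  rfl

lemma hasDerivAt_inner_expB (f h : StateSpace l p) (ξ : ℝ) :
    HasDerivAt (fun R : ℝ => (inner ℂ (D.expB R f) (D.expB R h) : ℂ))
      (-inner ℂ (D.mode f ξ) (D.sigmaB (D.mode h ξ))) ξ := by
  refine ((D.hasDerivAt_expB_apply ξ f).inner ℂ (D.hasDerivAt_expB_apply ξ h)).congr_deriv ?_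
  rw [mode, mode, ← inner_imB]
  simp only [iB, imB, smul_apply, sub_apply, inner_smul_left, inner_smul_right, inner_sub_right,
    ContinuousLinearMap.adjoint_inner_right, Complex.conj_I, Complex.inv_I]
  ring

/-- The energy lost by the state between 0 and R is exactly the output through σ_B. The expression
is therefore constant in R, and the limit defining the mode product is trivial. -/
lemma inner_add_integral_mode (f h : StateSpace l p) (R : ℝ) :
    inner ℂ (D.expB R f) (D.expB R h)
      + ∫ ξ in (0 : ℝ)..R, inner ℂ (D.mode f ξ) (D.sigmaB (D.mode h ξ)) = inner ℂ f h := by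
  have hm : ∀ k, Continuous (D.mode k) := fun k => D.PhiT.continuous.comp (D.continuous_expB_apply k)
  have hc : Continuous fun ξ => (inner ℂ (D.mode f ξ) (D.sigmaB (D.mode h ξ)) : ℂ) :=
    (hm f).inner (D.sigmaB.continuous.comp (hm h))
  have h1 := intervalIntegral.integral_eq_sub_of_hasDerivAt
    (fun ξ _ => D.hasDerivAt_inner_expB f h ξ) (hc.neg.intervalIntegrable 0 R)
  rw [intervalIntegral.integral_neg] at h1
  rw [neg_eq_iff_eq_neg.1 h1, expB_zero]
  simp

lemma HasModeInner.eq_inner {h f : StateSpace l p} {c : ℂ}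
    (hc : D.HasModeInner (D.mode h) (D.mode f) c) : c = inner ℂ f h := by
  obtain ⟨h', _, f', _, hh, hf, hlim⟩ := hc
  rw [← D.mode_injective hh, ← D.mode_injective hf] at hlim
  simp only [inner_add_integral_mode] at hlim
  exact tendsto_nhds_unique hlim tendsto_const_nhds

/-- The adjoint of the unitary operator `Ũ` is its inverse. -/
lemma IsAdjointMode.eq_mode {φ : ℝ → OuterSpace m} (hφ : φ ∈ D.modeSpace) {h : StateSpace l p}
    (hh : D.IsAdjointMode φ h) : φ = D.mode h := by
  obtain ⟨h', hh', rfl⟩ := hφ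
  have he := HasModeInner.eq_inner D (hh.2 (h - h') (D.principal.sub_mem hh.1 hh'))
  have hz : inner ℂ (h - h') (h - h') = 0 := by
    rw [inner_sub_right, he, sub_self]
  rw [sub_eq_zero.1 (inner_self_eq_zero.1 hz)]

end Modes

/-- The solution of the integral equation is the mode of the solution of
`h = T(-2x, -2t) (K g - M₀ h)`. -/
lemma eq_of_solvesIntegralEq {U ρ M : StateSpace l p →L[ℂ] StateSpace l p}
    (hU₁ : ContinuousLinearMap.adjoint U * U = 1) (hU₂ : U * ContinuousLinearMap.adjoint U = 1)
    (hBU : ContinuousLinearMap.adjoint D.B = -(U * D.B * ContinuousLinearMap.adjoint U))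
    (hM : D.IsStrongIntegral ρ M) {b : ℝ} {g h : StateSpace l p} {x t : ℝ}
    (hφ : D.SolvesIntegralEq b U ρ g x t (D.mode h)) :
    h = D.T b (-2 * x) (-2 * t) ((ContinuousLinearMap.adjoint U * ρ * D.imB) g
      - (ContinuousLinearMap.adjoint U * M) h) := by
  set K := ContinuousLinearMap.adjoint U * ρ * D.imB with hK
  have hT : ∀ ξ : ℝ, ∀ v, D.T b (-2 * x + ξ) (-2 * t) v = D.expB ξ (D.T b (-2 * x) (-2 * t) v) := by
    intro ξ v
    rw [T_eq_phase, T_eq_phase, D.expB_eq_phase b, ← mul_apply_eq_comp, ← phase_add, zero_add,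
      add_comm ξ]
  have hT' : ∀ ξ η : ℝ, ∀ v,
      D.T b (-2 * x + ξ + η) (-2 * t) v = D.T b (-2 * x + ξ) (-2 * t) (D.expB η v) := by
    intro ξ η v
    rw [T_eq_phase, T_eq_phase, D.expB_eq_phase b, ← mul_apply_eq_comp, ← phase_add, add_zero]
  -- The colligation condition absorbs Φ̃*σ_BΦ̃ into K.
  have hΨ : ∀ y s v, D.Psi b U ρ y s (D.PhiT v) = D.PhiT (D.T b y s (K v)) := by
    intro y s v
    rw [hK, imB_eq]
    rfl
  refine sub_eq_zero.1 (D.eq_zero_of_mode_eq_zero fun ξ hξ => ?_)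
  obtain ⟨J, hJ, he⟩ := hφ ξ hξ
  have hlim := ((D.PhiT ∘L D.T b (-2 * x + ξ) (-2 * t)).continuous.tendsto _).comp
    (D.adjoint_mul_tendsto hU₁ hU₂ hBU hM h)
  -- The shift by η splits off as e^(iηB) next to K, so the improper integral is Φ̃T applied to the
  -- strong integral for M₀h.
  have hJe : J = D.PhiT (D.T b (-2 * x + ξ) (-2 * t) ((ContinuousLinearMap.adjoint U * M) h)) := by
    refine tendsto_nhds_unique hJ (hlim.congr fun R => ?_)
    rw [Function.comp_apply, ← integral_map_comm _ (D.continuous_sandwich K h)]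
    refine intervalIntegral.integral_congr fun η _ => ?_
    simp only
    rw [mode, hΨ, hT']
    rfl
  rw [mode_sub, he, hJe, hΨ]
  simp only [mode, ← hT, map_sub]
  abel

end TriangularData

/-! ### The solution of the integral equation as the solitonic combination. -/

namespace TriangularData

variable {l : ℝ} {p m r : ℕ} (D : TriangularData l p m r)

/-- Applying e^θ to the equation for h gives Γh = e^(-θ)Kg with K = -(PM₀ + M₀P). Adding ΓPg cancels
e^(-θ)M₀Pg and leaves Γ_x g. -/
lemma add_iB_eq_logDerivWave {K M₀ : StateSpace l p →L[ℂ] StateSpace l p}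
    (hS : D.iB * M₀ + M₀ * D.iB = -K) {b x t : ℝ}
    (hu : IsUnit (twoWave b D.iB M₀ x t)) {g h : StateSpace l p}
    (hh : h = D.T b (-2 * x) (-2 * t) (K g - M₀ h)) :
    h + D.iB g = logDerivWave b D.iB M₀ x t g := by
  set E := phase b D.iB x t with hE
  set E' := phase b D.iB (-x) (-t) with hE'
  have h1 : E h + E' (M₀ h) = E' (K g) := by
    conv_lhs => enter [1]; rw [hh]
    have e : E * D.T b (-2 * x) (-2 * t) = E' := by
      rw [T_eq_phase, hE, ← phase_add, hE']
      congr 1 <;> ring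
    rw [← mul_apply_eq_comp, e, map_sub]
    abel
  have hK : K g = -(D.iB (M₀ g)) - M₀ (D.iB g) := by
    have := congrArg (fun X : StateSpace l p →L[ℂ] StateSpace l p => X g) hS
    have h2 : D.iB (M₀ g) + M₀ (D.iB g) = -K g := this
    rw [← neg_neg (K g), ← h2]
    abel
  have hc : ∀ v, E' (D.iB v) = D.iB (E' v) := fun v =>
    congrArg (fun X : StateSpace l p →L[ℂ] StateSpace l p => X v)
      (commute_phase b D.iB (-x) (-t)).eq.symm
  have hc' : ∀ v, E (D.iB v) = D.iB (E v) := fun v =>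
    congrArg (fun X : StateSpace l p →L[ℂ] StateSpace l p => X v)
      (commute_phase b D.iB x t).eq.symm
  have h3 : twoWave b D.iB M₀ x t (h + D.iB g) = twoWaveX b D.iB M₀ x t g := by
    have e1 : ∀ v, twoWave b D.iB M₀ x t v = E v + E' (M₀ v) := fun v => rfl
    have e2 : twoWaveX b D.iB M₀ x t g = D.iB (E g) - D.iB (E' (M₀ g)) := map_sub D.iB _ _
    rw [map_add, e1 h, e1 (D.iB g), h1, hK, e2, hc', ← hc, map_sub, map_neg]
    abel
  set G : StateSpace l p →L[ℂ] StateSpace l p := Ring.inverse (twoWave b D.iB M₀ x t) with hG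
  have h4 : (G * twoWave b D.iB M₀ x t) (h + D.iB g) = G (twoWaveX b D.iB M₀ x t g) :=
    congrArg (fun v => G v) h3
  rw [hG, Ring.inverse_mul_cancel _ hu] at h4
  exact h4

end TriangularData

/-! ### The operator and vector KdV equations. -/

section Equations

variable {𝔸 : Type*} [NormedRing 𝔸] [NormedAlgebra ℝ 𝔸] [CompleteSpace 𝔸] {b : ℝ} {P M : 𝔸}
  {x t : ℝ}

lemma iteratedDeriv_logDerivWave (hx : ∀ᶠ y in 𝓝 x, IsUnit (twoWave b P M y t)) :
    iteratedDeriv 3 (fun y => logDerivWave b P M y t) x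
      = (-2 : ℝ) • ((-(logDerivWave b P M x t) ^ 2 + conjSq b P M x t) ^ 2
        + logDerivWave b P M x t * ((-2 : ℝ) • (logDerivWave b P M x t
        * (-(logDerivWave b P M x t) ^ 2 + conjSq b P M x t)))) :=
  iteratedDeriv_three_of_hasDerivAt (hx.mono fun _ h => hasDerivAt_logDerivWave_fst h)
    (hx.mono fun _ h => hasDerivAt_logDerivWave_fst₂ h) (hasDerivAt_logDerivWave_fst₃ hx.self_of_nhds)

/-- The nonlinear operator KdV equation. -/
lemma logDerivWave_kdv (hx : ∀ᶠ y in 𝓝 x, IsUnit (twoWave b P M y t)) :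
    (4 : ℝ) • deriv (fun s => logDerivWave b P M x s) t
      + b • ((6 : ℝ) • (deriv (fun y => logDerivWave b P M y t) x) ^ 2
        + iteratedDeriv 3 (fun y => logDerivWave b P M y t) x) = 0 := by
  have hu := hx.self_of_nhds
  rw [(hasDerivAt_logDerivWave_snd hu).deriv, (hasDerivAt_logDerivWave_fst hu).deriv,
    iteratedDeriv_logDerivWave hx]
  exact kdv_identity b _ _

end Equations

lemma contDiffAt_apply_const {H Z : Type*} [NormedAddCommGroup H] [NormedSpace ℂ H]
    [NormedAddCommGroup Z] [NormedSpace ℝ Z] {n : WithTop ℕ∞} {c : Z → H →L[ℂ] H} {z : Z}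
    (hc : ContDiffAt ℝ n c z) (v : H) : ContDiffAt ℝ n (fun y => c y v) z :=
  (((ContinuousLinearMap.apply ℂ H v).restrictScalars ℝ).contDiff.contDiffAt).comp z hc

lemma iteratedDeriv_three_apply_const {H : Type*} [NormedAddCommGroup H] [NormedSpace ℂ H]
    {c c₁ c₂ : ℝ → H →L[ℂ] H} {c₃ : H →L[ℂ] H} {x : ℝ}
    (h₁ : ∀ᶠ y in 𝓝 x, HasDerivAt c (c₁ y) y) (h₂ : ∀ᶠ y in 𝓝 x, HasDerivAt c₁ (c₂ y) y)
    (h₃ : HasDerivAt c₂ c₃ x) (g : H) : iteratedDeriv 3 (fun y => c y g) x = c₃ g :=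
  iteratedDeriv_three_of_hasDerivAt (f₁ := fun y => c₁ y g) (f₂ := fun y => c₂ y g)
    (h₁.mono fun _ h => hasDerivAt_apply_const h g)
    (h₂.mono fun _ h => hasDerivAt_apply_const h g) (hasDerivAt_apply_const h₃ g)

section VectorEquation

variable {H : Type*} [NormedAddCommGroup H] [NormedSpace ℂ H] [CompleteSpace H]
  {b : ℝ} {P M : H →L[ℂ] H} {x t : ℝ}

lemma iteratedDeriv_logDerivWave_apply (hx : ∀ᶠ y in 𝓝 x, IsUnit (twoWave b P M y t)) (g : H) :
    iteratedDeriv 3 (fun y => logDerivWave b P M y t g) x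
      = iteratedDeriv 3 (fun y => logDerivWave b P M y t) x g := by
  rw [iteratedDeriv_logDerivWave hx]
  exact iteratedDeriv_three_apply_const
    (hx.mono fun _ h => hasDerivAt_logDerivWave_fst h)
    (hx.mono fun _ h => hasDerivAt_logDerivWave_fst₂ h)
    (hasDerivAt_logDerivWave_fst₃ hx.self_of_nhds) g

/-- The operator KdV equation applied to a vector. -/
lemma logDerivWave_apply_kdv (hx : ∀ᶠ y in 𝓝 x, IsUnit (twoWave b P M y t)) (g : H) :
    (4 : ℝ) • deriv (fun s => logDerivWave b P M x s g) t
      + b • ((6 : ℝ) • (deriv (fun y => logDerivWave b P M y t) x)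
          (deriv (fun y => logDerivWave b P M y t g) x)
        + iteratedDeriv 3 (fun y => logDerivWave b P M y t g) x) = 0 := by
  have hu := hx.self_of_nhds
  have h := congrArg (fun X : H →L[ℂ] H => X g) (logDerivWave_kdv hx)
  rw [iteratedDeriv_logDerivWave_apply hx,
    (hasDerivAt_apply_const (hasDerivAt_logDerivWave_snd hu) g).deriv,
    (hasDerivAt_apply_const (hasDerivAt_logDerivWave_fst hu) g).deriv]
  rw [(hasDerivAt_logDerivWave_snd hu).deriv, (hasDerivAt_logDerivWave_fst hu).deriv] at h
  rw [(hasDerivAt_logDerivWave_fst hu).deriv]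
  rw [pow_two (-(logDerivWave b P M x t) ^ 2 + conjSq b P M x t)] at h
  exact h

end VectorEquation

end KdVColligation

theorem theoremt8 {l : ℝ} {p m r : ℕ} (D : KdVColligation.TriangularData l p m r)
    (U ρ M : KdVColligation.StateSpace l p →L[ℂ] KdVColligation.StateSpace l p)
    (hU₁ : ContinuousLinearMap.adjoint U * U = 1) (hU₂ : U * ContinuousLinearMap.adjoint U = 1)
    (hBU : ContinuousLinearMap.adjoint D.B = -(U * D.B * ContinuousLinearMap.adjoint U))
    (hM : D.IsStrongIntegral ρ M)
    (b : ℝ) (g : KdVColligation.StateSpace l p) (hg : g ∈ D.GB)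
    (Ω : Set (ℝ × ℝ)) (hΩ : IsOpen Ω) (hΓ : ∀ x t : ℝ, (x, t) ∈ Ω → IsUnit (D.Gam b U M x t))
    (φ : ℝ → ℝ → ℝ → KdVColligation.OuterSpace m)
    (hφ : ∀ x t : ℝ, (x, t) ∈ Ω → φ x t ∈ D.modeSpace)
    (hφeq : ∀ x t : ℝ, (x, t) ∈ Ω → D.SolvesIntegralEq b U ρ g x t (φ x t))
    (h : ℝ → ℝ → KdVColligation.StateSpace l p)
    (hh : ∀ x t : ℝ, (x, t) ∈ Ω → D.IsAdjointMode (φ x t) (h x t)) :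
    (∀ x t : ℝ, (x, t) ∈ Ω → h x t + Complex.I • D.B g = D.soliton b U M x t g) ∧
    ContDiffOn ℝ (⊤ : ℕ∞) (fun z : ℝ × ℝ => D.soliton b U M z.1 z.2) Ω ∧
    ContDiffOn ℝ (⊤ : ℕ∞) (fun z : ℝ × ℝ => h z.1 z.2 + Complex.I • D.B g) Ω ∧
    (∀ x t : ℝ, (x, t) ∈ Ω →
      (4 : ℝ) • deriv (fun s => D.soliton b U M x s) t
        + b • ((6 : ℝ) • (deriv (fun y => D.soliton b U M y t) x) ^ 2
          + iteratedDeriv 3 (fun y => D.soliton b U M y t) x) = 0) ∧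
    (∀ x t : ℝ, (x, t) ∈ Ω →
      (4 : ℝ) • deriv (fun s => h x s + Complex.I • D.B g) t
        + b • ((6 : ℝ) • (deriv (fun y => D.soliton b U M y t) x)
            (deriv (fun y => h y t + Complex.I • D.B g) x)
          + iteratedDeriv 3 (fun y => h y t + Complex.I • D.B g) x) = 0) := by
  set M₀ := ContinuousLinearMap.adjoint U * M with hM₀
  have hsol : ∀ x t, D.soliton b U M x t = KdVColligation.logDerivWave b D.iB M₀ x t :=
    KdVColligation.TriangularData.soliton_eq_logDerivWave hU₁ hU₂ hBU M b
  have hunit : ∀ x t : ℝ, (x, t) ∈ Ω → IsUnit (KdVColligation.twoWave b D.iB M₀ x t) := by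
    intro x t hxt
    rw [← KdVColligation.TriangularData.Gam_eq_twoWave hU₁ hU₂ hBU]
    exact hΓ x t hxt
  have hsyl := D.sylvester (D.adjoint_mul_tendsto hU₁ hU₂ hBU hM)
  have hu : ∀ x t : ℝ, (x, t) ∈ Ω →
      h x t + Complex.I • D.B g = KdVColligation.logDerivWave b D.iB M₀ x t g := by
    intro x t hxt
    have hmode := KdVColligation.TriangularData.IsAdjointMode.eq_mode D (hφ x t hxt) (hh x t hxt)
    have heq := hφeq x t hxt
    rw [hmode] at heq
    exact D.add_iB_eq_logDerivWave hsyl (hunit x t hxt)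
      (D.eq_of_solvesIntegralEq hU₁ hU₂ hBU hM heq)
  -- Openness of Ω upgrades the pointwise identity u = Sg to equality of germs along each axis,
  -- which is what derivatives require.
  have hevx : ∀ x t : ℝ, (x, t) ∈ Ω → ∀ᶠ y in 𝓝 x, (y, t) ∈ Ω := fun x t hxt =>
    (Continuous.prodMk continuous_id continuous_const).continuousAt.eventually_mem
      (hΩ.mem_nhds hxt)
  have hevt : ∀ x t : ℝ, (x, t) ∈ Ω → ∀ᶠ s in 𝓝 t, (x, s) ∈ Ω := fun x t hxt =>
    (Continuous.prodMk continuous_const continuous_id).continuousAt.eventually_mem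
      (hΩ.mem_nhds hxt)
  have hsmooth : ∀ z ∈ Ω, ContDiffAt ℝ (⊤ : ℕ∞)
      (fun z : ℝ × ℝ => KdVColligation.logDerivWave b D.iB M₀ z.1 z.2) z := fun z hz =>
    KdVColligation.contDiffAt_logDerivWave (hunit z.1 z.2 hz)
  simp only [hsol]
  refine ⟨hu, fun z hz => (hsmooth z hz).contDiffWithinAt, ?_, ?_, ?_⟩
  · refine ContDiffOn.congr (f := fun z : ℝ × ℝ =>
      KdVColligation.logDerivWave b D.iB M₀ z.1 z.2 g) (fun z hz => ?_) fun z hz => hu z.1 z.2 hz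
    exact (KdVColligation.contDiffAt_apply_const (hsmooth z hz) g).contDiffWithinAt
  · intro x t hxt
    exact KdVColligation.logDerivWave_kdv ((hevx x t hxt).mono fun y hy => hunit y t hy)
  · intro x t hxt
    have e1 : (fun y => h y t + Complex.I • D.B g)
        =ᶠ[𝓝 x] fun y => KdVColligation.logDerivWave b D.iB M₀ y t g :=
      (hevx x t hxt).mono fun y hy => hu y t hy
    have e2 : (fun s => h x s + Complex.I • D.B g)
        =ᶠ[𝓝 t] fun s => KdVColligation.logDerivWave b D.iB M₀ x s g :=
      (hevt x t hxt).mono fun s hs => hu x s hs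
    rw [e1.deriv_eq, e2.deriv_eq, e1.iteratedDeriv_eq 3]
    exact KdVColligation.logDerivWave_apply_kdv
      ((hevx x t hxt).mono fun y hy => hunit y t hy) g
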